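/- Let $k$ be an algebraically closed field and let $C$ be a finite-dimensional associative unital $k$-algebra of global dimension at most $2$. All modules are finitely generated right modules; $D=\operatorname{Hom}_k(-,k)$. Let $E=\operatorname{Ext}^2_C(DC,C)$, with its natural $C$-$C$-bimodule structure, and let $B=C\ltimes E$ be the trivial extension, that is, $C\oplus E$ with multiplication $(c,e)(c',e')=(cc',ce'+ec')$. Every $C$-module $M$ is regarded as a $B$-module through $m\cdot(c,e)=mc$. For a finite-dimensional $k$-algebra $\Lambda$ let $\tau_\Lambda=D\operatorname{Tr}$ and $\tau_\Lambda^{-1}=\operatorname{Tr}D$ be the Auslander–Reiten translations; for a $\Lambda$-module $X$ let $\Omega_\Lambda X$ be the kernel of a projective cover of $X$ and $\Omega_\Lambda^{-1}X$ the cokernel of an injective envelope of $X$. A $\Lambda$-module $X$ is $\tau_\Lambda$-rigid if $\operatorname{Hom}_\Lambda(X,\tau_\Lambda X)=0$. $\operatorname{Gen}M$ is the class of all modules $X$ such that there is an epimorphism $M^d\to X$ for some integer $d\ge 0$. A $C$-module $M$ is partial tilting if $\operatorname{pd}_CM\le 1$ and $\operatorname{Ext}^1_C(M,M)=0$. Let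 $M$ be a $C$-module and let $f\colon P_0\to M$ be a projective cover in $\operatorname{mod}C$. 1. If $M$ is $\tau_C$-rigid and $\operatorname{Hom}_C(\tau_C^{-1}\Omega_C^{-1}P_0,X)=0$ for every $X\in\operatorname{Gen}M$, then $M$ is $\tau_B$-rigid. 2. If $M$ is $\tau_C$-rigid and $\operatorname{pd}_CX\le 1$ for every $X\in\operatorname{Gen}M$, then $M$ is $\tau_B$-rigid. 3. If $M$ is $\tau_C$-rigid and $P_0$ is $\tau_B$-rigid, then $M$ is $\tau_B$-rigid. 4. If $M$ is partial tilting and $\operatorname{Hom}_C(\Omega_C(\tau_C^{-1}\Omega_C^{-1}P_0),M)=0$, then $M$ is $\tau_B$-rigid. -/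

import Mathlib

open CategoryTheory

universe u

/-!
Conventions.  A right module over a ring `Λ` is a module over `Λᵐᵒᵖ`, a left module is a module over
`Λ`.  For a finite-dimensional algebra `Λ` over the field `k`, the category `mod Λ` of finitely
generated right modules consists of the `M : ModuleCat Λᵐᵒᵖ` with `Module.Finite Λᵐᵒᵖ M`.
-/

namespace RelExt

noncomputable section

/-! ### Projective covers and injective envelopes -/

section Covers

variable {R : Type u} [Ring R]

/-- `f : P ⟶ M` is a projective cover: `P` is projective and `f` is an epimorphism with superfluous
kernel. -/
structure IsProjectiveCover {P M : ModuleCat.{u} R} (f : P ⟶ M) : Prop where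
  projective : Module.Projective R P
  surjective : Function.Surjective f
  superfluous : ∀ N : Submodule R P, N ⊔ LinearMap.ker f.hom = ⊤ → N = ⊤

/-- `f : M ⟶ I` is an injective envelope: `I` is injective and `f` is a monomorphism with essential
image. -/
structure IsInjectiveEnvelope {M I : ModuleCat.{u} R} (f : M ⟶ I) : Prop where
  injective_obj : Module.Injective R I
  injective : Function.Injective f
  essential : ∀ N : Submodule R I, N ⊓ LinearMap.range f.hom = ⊥ → N = ⊥

/-- Among all epimorphisms from finitely generated projective modules, one of minimal length is a
projective cover. -/
theorem exists_projectiveCover [IsArtinianRing R] (M : ModuleCat.{u} R) [Module.Finite R M] :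
    ∃ (P : ModuleCat.{u} R) (f : P ⟶ M), Module.Finite R P ∧ IsProjectiveCover f := by
  let S : Set ℕ∞ := {l | ∃ (P : ModuleCat.{u} R) (f : P ⟶ M), Module.Finite R P ∧
    Module.Projective R P ∧ Function.Surjective f ∧ Module.length R P = l}
  have hS : S.Nonempty := by
    obtain ⟨n, g, hg⟩ := Module.Finite.exists_fin' R M
    exact ⟨_, ModuleCat.of R (Fin n → R), ModuleCat.ofHom g,
      inferInstanceAs (Module.Finite R (Fin n → R)),
      inferInstanceAs (Module.Projective R (Fin n → R)), hg, rfl⟩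
  obtain ⟨P, f, hfin, hproj, hsurj, hl⟩ := WellFounded.min_mem wellFounded_lt S hS
  refine ⟨P, f, hfin, hproj, hsurj, fun N hN => ?_⟩
  have hNsurj : Function.Surjective (f.hom ∘ₗ N.subtype) := by
    intro m
    obtain ⟨p, rfl⟩ := hsurj m
    have hp : p ∈ N ⊔ LinearMap.ker f.hom := hN ▸ Submodule.mem_top
    obtain ⟨a, ha, b, hb, rfl⟩ := Submodule.mem_sup.mp hp
    refine ⟨⟨a, ha⟩, ?_⟩
    have hb' : f.hom b = 0 := hb
    simp [hb']
  obtain ⟨g, hg⟩ := Module.projective_lifting_property (f.hom ∘ₗ N.subtype) f.hom hNsurj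
  let e : Module.End R P := N.subtype ∘ₗ g
  have he : f.hom ∘ₗ e = f.hom := hg
  have hen : ∀ n, f.hom ∘ₗ (e ^ n) = f.hom := by
    intro n
    induction n with
    | zero => rfl
    | succ n ih => rw [pow_succ', Module.End.mul_eq_comp, ← LinearMap.comp_assoc, he, ih]
  obtain ⟨n, hn, hn1⟩ :=
    (e.eventually_isCompl_ker_pow_range_pow.and (Filter.eventually_ge_atTop 1)).exists
  let Q := LinearMap.range (e ^ n)
  have hQN : Q ≤ N := by
    rintro _ ⟨x, rfl⟩
    obtain ⟨m, rfl⟩ : ∃ m, n = m + 1 := ⟨n - 1, by omega⟩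
    rw [pow_succ']
    exact (g ((e ^ m) x)).2
  have hQproj : Module.Projective R Q :=
    Module.Projective.of_split Q.subtype (Submodule.projectionOnto _ _ hn.symm)
      (by ext x; simp [Q])
  have hQS : Module.length R Q ∈ S := by
    refine ⟨ModuleCat.of R Q, ModuleCat.ofHom (f.hom ∘ₗ Q.subtype), inferInstanceAs
      (Module.Finite R Q), hQproj, ?_, rfl⟩
    intro m
    obtain ⟨p, rfl⟩ := hsurj m
    exact ⟨⟨(e ^ n) p, p, rfl⟩, LinearMap.congr_fun (hen n) p⟩
  have hQtop : Q = ⊤ := by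
    by_contra h
    refine WellFounded.not_lt_min wellFounded_lt S hQS ?_
    rw [← hl]
    exact Submodule.length_lt h
  exact top_le_iff.mp (hQtop ▸ hQN)

/-- Among all monomorphisms into injective modules of finite length, one of minimal length is an
injective envelope. -/
theorem exists_injectiveEnvelope [IsArtinianRing R] (M : ModuleCat.{u} R)
    (hM : ∃ (I : ModuleCat.{u} R) (f : M ⟶ I), Module.Finite R I ∧ Module.Injective R I ∧
      Function.Injective f) :
    ∃ (I : ModuleCat.{u} R) (f : M ⟶ I), Module.Finite R I ∧ IsInjectiveEnvelope f := by
  let S : Set ℕ∞ := {l | ∃ (I : ModuleCat.{u} R) (f : M ⟶ I), Module.Finite R I ∧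
    Module.Injective R I ∧ Function.Injective f ∧ Module.length R I = l}
  have hS : S.Nonempty := by
    obtain ⟨I, f, h1, h2, h3⟩ := hM
    exact ⟨_, I, f, h1, h2, h3, rfl⟩
  obtain ⟨I, f, hfin, hinj, hf, hl⟩ := WellFounded.min_mem wellFounded_lt S hS
  refine ⟨I, f, hfin, hinj, hf, fun N hN => ?_⟩
  have hNinj : Function.Injective (N.mkQ ∘ₗ f.hom) := by
    rw [← LinearMap.ker_eq_bot, LinearMap.ker_eq_bot']
    intro m hm
    have h1 : f.hom m ∈ N := by simpa using hm
    have h2 : f.hom m ∈ N ⊓ LinearMap.range f.hom := ⟨h1, m, rfl⟩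
    rw [hN] at h2
    exact hf (by simpa using h2)
  obtain ⟨g, hg⟩ := hinj.out (N.mkQ ∘ₗ f.hom) hNinj f.hom
  let e : Module.End R I := g ∘ₗ N.mkQ
  have he : e ∘ₗ f.hom = f.hom := LinearMap.ext hg
  have hen : ∀ n, (e ^ n) ∘ₗ f.hom = f.hom := by
    intro n
    induction n with
    | zero => rfl
    | succ n ih => rw [pow_succ, Module.End.mul_eq_comp, LinearMap.comp_assoc, he, ih]
  obtain ⟨n, hn, hn1⟩ :=
    (e.eventually_isCompl_ker_pow_range_pow.and (Filter.eventually_ge_atTop 1)).exists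
  let Q := LinearMap.range (e ^ n)
  have hNQ : N ≤ LinearMap.ker (e ^ n) := by
    intro x hx
    obtain ⟨m, rfl⟩ : ∃ m, n = m + 1 := ⟨n - 1, by omega⟩
    have : e x = 0 := by simp [e, (Submodule.Quotient.mk_eq_zero N).mpr hx]
    rw [LinearMap.mem_ker, pow_succ, Module.End.mul_apply, this, map_zero]
  have hQinj : Module.Injective R Q := by
    refine ⟨fun X Y _ _ _ _ a ha b => ?_⟩
    obtain ⟨h, hh⟩ := hinj.out a ha (Q.subtype ∘ₗ b)
    refine ⟨Submodule.projectionOnto _ _ hn.symm ∘ₗ h, fun x => ?_⟩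
    simp [hh, Q]
  have hQS : Module.length R Q ∈ S := by
    have hmem : ∀ m, f.hom m ∈ Q := fun m => ⟨f.hom m, LinearMap.congr_fun (hen n) m⟩
    refine ⟨ModuleCat.of R Q, ModuleCat.ofHom (f.hom.codRestrict Q hmem), inferInstanceAs
      (Module.Finite R Q), hQinj, ?_, rfl⟩
    intro x y hxy
    exact hf (congrArg Subtype.val hxy)
  have hQtop : Q = ⊤ := by
    by_contra h
    refine WellFounded.not_lt_min wellFounded_lt S hQS ?_
    rw [← hl]
    exact Submodule.length_lt h
  have hker : LinearMap.ker (e ^ n) = ⊥ := by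
    have := hn.disjoint.eq_bot
    rwa [show LinearMap.range (e ^ n) = ⊤ from hQtop, inf_top_eq] at this
  exact le_bot_iff.mp (hker ▸ hNQ)

end Covers

/-! ### Duality, transpose, syzygies and the Auslander-Reiten translations -/

section Translations

attribute [local instance] ModuleCat.moduleOfAlgebraModule
attribute [local instance] ModuleCat.isScalarTower_of_algebra_moduleCat

theorem isArtinianRing_of_finiteDimensional (k : Type u) [Field k] {R : Type u} [Ring R]
    [Algebra k R] [FiniteDimensional k R] : IsArtinianRing R := IsArtinianRing.of_finite k R

/-- `Λ` as a left module over itself. -/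
def leftRegular (Λ : Type u) [Ring Λ] : ModuleCat.{u} Λ := ModuleCat.of Λ Λ

/-- `Λ` as a right module over itself. -/
def rightRegular (Λ : Type u) [Ring Λ] : ModuleCat.{u} Λᵐᵒᵖ := ModuleCat.of Λᵐᵒᵖ Λ

instance (Λ : Type u) [Ring Λ] : Module.Finite Λ (leftRegular Λ) :=
  inferInstanceAs (Module.Finite Λ Λ)

instance (Λ : Type u) [Ring Λ] : Module.Finite Λᵐᵒᵖ (rightRegular Λ) :=
  Module.Finite.of_surjective
    (LinearMap.toSpanSingleton Λᵐᵒᵖ (rightRegular Λ) (show rightRegular Λ from (1 : Λ)))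
    fun x => ⟨MulOpposite.op (show Λ from x), one_mul (show Λ from x)⟩

variable (k : Type u) [Field k]

section Generic

variable {R : Type u} [Ring R] [Algebra k R] [FiniteDimensional k R]

theorem finiteDimensional_of_finite (M : ModuleCat.{u} R) [Module.Finite R M] :
    Module.Finite k M := Module.Finite.trans R M

/-- The projective cover of a finitely generated module. -/
def projectiveCover (M : ModuleCat.{u} R) [Module.Finite R M] : ModuleCat.{u} R :=
  haveI := isArtinianRing_of_finiteDimensional k (R := R)
  (exists_projectiveCover M).choose

def projectiveCoverMap (M : ModuleCat.{u} R) [Module.Finite R M] : projectiveCover k M ⟶ M :=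
  haveI := isArtinianRing_of_finiteDimensional k (R := R)
  (exists_projectiveCover M).choose_spec.choose

instance (M : ModuleCat.{u} R) [Module.Finite R M] : Module.Finite R (projectiveCover k M) :=
  haveI := isArtinianRing_of_finiteDimensional k (R := R)
  (exists_projectiveCover M).choose_spec.choose_spec.1

theorem isProjectiveCover_projectiveCoverMap (M : ModuleCat.{u} R) [Module.Finite R M] :
    IsProjectiveCover (projectiveCoverMap k M) :=
  haveI := isArtinianRing_of_finiteDimensional k (R := R)
  (exists_projectiveCover M).choose_spec.choose_spec.2

/-- The first syzygy `Ω M`: the kernel of the projective cover of `M`. -/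
def syzygy (M : ModuleCat.{u} R) [Module.Finite R M] : ModuleCat.{u} R :=
  ModuleCat.of R (LinearMap.ker (projectiveCoverMap k M).hom)

instance (M : ModuleCat.{u} R) [Module.Finite R M] : Module.Finite R (syzygy k M) :=
  haveI := isArtinianRing_of_finiteDimensional k (R := R)
  inferInstanceAs (Module.Finite R (LinearMap.ker (projectiveCoverMap k M).hom))

/-- The map `P₁ → P₀` of the minimal projective presentation `P₁ → P₀ → M → 0`, where `P₀` is the
projective cover of `M` and `P₁` that of `Ω M`. -/
def presentationMap (M : ModuleCat.{u} R) [Module.Finite R M] :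
    projectiveCover k (syzygy k M) →ₗ[R] projectiveCover k M :=
  (LinearMap.ker (projectiveCoverMap k M).hom).subtype ∘ₗ (projectiveCoverMap k (syzygy k M)).hom

end Generic

variable {Λ : Type u} [Ring Λ] [Algebra k Λ]

/-- The left action of `Λ` on `Hom_k(M, k)` for a right module `M`: `(a • f) m = f (m a)`. -/
@[reducible]
def dualRightModule (M : ModuleCat.{u} Λᵐᵒᵖ) : Module Λ (M →ₗ[k] k) where
  smul a f := f ∘ₗ Algebra.lsmul k k M (MulOpposite.op a)
  one_smul f := by ext m; exact congrArg f (one_smul Λᵐᵒᵖ m)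
  mul_smul a b f := by ext m; exact congrArg f (mul_smul (MulOpposite.op b) (MulOpposite.op a) m)
  smul_zero _ := rfl
  smul_add _ _ _ := rfl
  add_smul a b f := by
    ext m
    exact (congrArg f (add_smul (MulOpposite.op a) (MulOpposite.op b) m)).trans (map_add f _ _)
  zero_smul f := by ext m; exact (congrArg f (zero_smul Λᵐᵒᵖ m)).trans (map_zero f)

/-- The standard duality `D = Hom_k(-, k)` from right modules to left modules. -/
def dualRight (M : ModuleCat.{u} Λᵐᵒᵖ) : ModuleCat.{u} Λ :=
  letI := dualRightModule k M
  ModuleCat.of Λ (M →ₗ[k] k)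

/-- The `k`-linear forms on a left module. -/
abbrev LeftForms (N : ModuleCat.{u} Λ) : Type u := N →ₗ[k] k

/-- The right action of `Λ` on `Hom_k(N, k)` for a left module `N`: `(f • a) n = f (a n)`. -/
@[reducible]
def dualLeftModule (N : ModuleCat.{u} Λ) : Module Λᵐᵒᵖ (LeftForms k N) where
  smul a f := f ∘ₗ Algebra.lsmul k k N a.unop
  one_smul f := by ext n; exact congrArg f (one_smul Λ n)
  mul_smul a b f := by ext n; exact congrArg f (mul_smul b.unop a.unop n)
  smul_zero _ := rfl
  smul_add _ _ _ := rfl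
  add_smul a b f := by
    ext n
    exact (congrArg f (add_smul a.unop b.unop n)).trans (map_add f _ _)
  zero_smul f := by ext n; exact (congrArg f (zero_smul Λ n)).trans (map_zero f)

/-- The standard duality `D = Hom_k(-, k)` from left modules to right modules. -/
def dualLeft (N : ModuleCat.{u} Λ) : ModuleCat.{u} Λᵐᵒᵖ :=
  letI := dualLeftModule k N
  ModuleCat.of Λᵐᵒᵖ (LeftForms k N)

/-- `D` on a morphism `h` of left modules: `f ↦ f ∘ h`. -/
def dualLeftMap {N N' : ModuleCat.{u} Λ} (h : N ⟶ N') : dualLeft k N' ⟶ dualLeft k N :=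
  letI := dualLeftModule k N
  letI := dualLeftModule k N'
  ModuleCat.ofHom (Y := (N →ₗ[k] k)) (X := (N' →ₗ[k] k))
    { toFun := fun f => f ∘ₗ h.hom.restrictScalars k
      map_add' := fun _ _ => rfl
      map_smul' := fun a f => by
        ext n
        exact congrArg f (h.hom.map_smul a.unop n).symm }

theorem dualLeft_self_injective :
    Module.Injective Λᵐᵒᵖ (dualLeft k (leftRegular Λ)) := by
  let := dualLeftModule k (leftRegular Λ)
  refine ⟨fun X Y _ _ _ _ i hi g => ?_⟩
  let : Module k X := Module.restrictScalars k Λᵐᵒᵖ X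
  let : Module k Y := Module.restrictScalars k Λᵐᵒᵖ Y
  have : IsScalarTower k Λᵐᵒᵖ X := IsScalarTower.restrictScalars k Λᵐᵒᵖ X
  have : IsScalarTower k Λᵐᵒᵖ Y := IsScalarTower.restrictScalars k Λᵐᵒᵖ Y
  let g' : X →ₗ[Λᵐᵒᵖ] LeftForms k (leftRegular Λ) := g
  have hgk : ∀ (c : k) (x : X) (a : Λ), g' (c • x) a = c * g' x a := fun c x a => by
    have h1 : c • x = (c • (1 : Λᵐᵒᵖ)) • x := by rw [smul_assoc, one_smul]
    rw [h1, map_smul]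
    change g' x ((c • (1 : Λ)) * a) = _
    rw [smul_mul_assoc, one_mul, Algebra.smul_def]
    exact map_smul (g' x) c (show leftRegular Λ from a)
  let φ : X →ₗ[k] k :=
    { toFun := fun x => g' x (1 : Λ)
      map_add' := fun x y => by rw [map_add]; rfl
      map_smul' := fun c x => hgk c x 1 }
  obtain ⟨r, hr⟩ := (i.restrictScalars k).exists_leftInverse_of_injective
    (LinearMap.ker_eq_bot.mpr hi)
  let ψ : Y →ₗ[k] k := φ ∘ₗ r
  have hψ : ∀ x, ψ (i x) = g' x (1 : Λ) := fun x => congrArg φ (LinearMap.congr_fun hr x)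
  let h : Y →ₗ[Λᵐᵒᵖ] LeftForms k (leftRegular Λ) :=
    { toFun := fun y =>
        { toFun := fun a => ψ (MulOpposite.op (show Λ from a) • y)
          map_add' := fun a b => by
            rw [← map_add, ← add_smul]; rfl
          map_smul' := fun c a => by
            rw [RingHom.id_apply, ← map_smul, ← smul_assoc]
            congr 2
            exact congrArg MulOpposite.op (algebraMap_smul Λ c (show Λ from a)) }
      map_add' := fun y z => by
        ext a
        change ψ (_ • (y + z)) = ψ _ + ψ _
        rw [smul_add, map_add]
      map_smul' := fun b y => by
        ext a
        change ψ (MulOpposite.op (show Λ from a) • b • y) =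
          ψ (MulOpposite.op (b.unop * (show Λ from a)) • y)
        rw [← mul_smul]
        rfl }
  refine ⟨h, fun x => ?_⟩
  change h (i x) = g' x
  ext a
  change ψ (MulOpposite.op (show Λ from a) • i x) = g' x a
  rw [← map_smul, hψ, map_smul]
  exact congrArg (g' x) (mul_one (show Λ from a))

section FiniteDimensional

variable [FiniteDimensional k Λ]

theorem dualRight_finite (M : ModuleCat.{u} Λᵐᵒᵖ) [Module.Finite Λᵐᵒᵖ M] :
    Module.Finite Λ (dualRight k M) := by
  let := dualRightModule k M
  have := finiteDimensional_of_finite k M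
  have : IsScalarTower k Λ (M →ₗ[k] k) := ⟨fun c a f => by
    ext m
    change f (MulOpposite.op (c • a) • m) = c • f (MulOpposite.op a • m)
    rw [MulOpposite.op_smul, smul_assoc, map_smul]⟩
  exact Module.Finite.of_restrictScalars_finite k Λ (M →ₗ[k] k)

instance (M : ModuleCat.{u} Λᵐᵒᵖ) [Module.Finite Λᵐᵒᵖ M] : Module.Finite Λ (dualRight k M) :=
  dualRight_finite k M

theorem dualLeft_finite (N : ModuleCat.{u} Λ) [Module.Finite Λ N] :
    Module.Finite Λᵐᵒᵖ (dualLeft k N) := by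
  let := dualLeftModule k N
  have := finiteDimensional_of_finite k N
  have : IsScalarTower k Λᵐᵒᵖ (N →ₗ[k] k) := ⟨fun c a f => by
    ext n
    change f ((c • a).unop • n) = c • f (a.unop • n)
    rw [MulOpposite.unop_smul, smul_assoc, map_smul]⟩
  exact Module.Finite.of_restrictScalars_finite k Λᵐᵒᵖ (N →ₗ[k] k)

instance (N : ModuleCat.{u} Λ) [Module.Finite Λ N] : Module.Finite Λᵐᵒᵖ (dualLeft k N) :=
  dualLeft_finite k N

/-- The transpose `Tr M` of a right module `M`: the left module that is the cokernel of
`Hom_Λ(P₀, Λ) → Hom_Λ(P₁, Λ)` for the minimal projective presentation `P₁ → P₀ → M → 0`. -/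
def transposeRight (M : ModuleCat.{u} Λᵐᵒᵖ) [Module.Finite Λᵐᵒᵖ M] : ModuleCat.{u} Λ :=
  ModuleCat.of Λ ((projectiveCover k (syzygy k M) →ₗ[Λᵐᵒᵖ] Λ) ⧸
    LinearMap.range (LinearMap.lcomp Λ Λ (presentationMap k M)))

/-- The transpose of a left module, which is a right module. -/
def transposeLeft (N : ModuleCat.{u} Λ) [Module.Finite Λ N] : ModuleCat.{u} Λᵐᵒᵖ :=
  ModuleCat.of Λᵐᵒᵖ ((projectiveCover k (syzygy k N) →ₗ[Λ] Λ) ⧸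
    LinearMap.range (LinearMap.lcomp Λᵐᵒᵖ Λ (presentationMap k N)))

/-- The Auslander-Reiten translation `τ M = D Tr M` in `mod Λ`. -/
def tau (M : ModuleCat.{u} Λᵐᵒᵖ) [Module.Finite Λᵐᵒᵖ M] : ModuleCat.{u} Λᵐᵒᵖ :=
  dualLeft k (transposeRight k M)

/-- The inverse Auslander-Reiten translation `τ⁻¹ M = Tr D M` in `mod Λ`. -/
def tauInv (M : ModuleCat.{u} Λᵐᵒᵖ) [Module.Finite Λᵐᵒᵖ M] : ModuleCat.{u} Λᵐᵒᵖ :=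
  transposeLeft k (dualRight k M)

instance (M : ModuleCat.{u} Λᵐᵒᵖ) [Module.Finite Λᵐᵒᵖ M] : Module.Finite Λᵐᵒᵖ (tauInv k M) := by
  let P := projectiveCover k (syzygy k (dualRight k M))
  have : Module.Finite k P := finiteDimensional_of_finite k P
  have : Module.Finite k (P →ₗ[Λ] Λ) :=
    Module.Finite.of_injective (LinearMap.restrictScalarsₗ k Λ P Λ k)
      (LinearMap.restrictScalars_injective k)
  have : Module.Finite Λᵐᵒᵖ (P →ₗ[Λ] Λ) := Module.Finite.of_restrictScalars_finite k Λᵐᵒᵖ _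
  exact inferInstanceAs (Module.Finite Λᵐᵒᵖ ((P →ₗ[Λ] Λ) ⧸
    LinearMap.range (LinearMap.lcomp Λᵐᵒᵖ Λ (presentationMap k (dualRight k M)))))

theorem exists_injectiveEnvelope_right (k : Type u) [Field k] {Λ : Type u} [Ring Λ]
    [Algebra k Λ] [FiniteDimensional k Λ] (M : ModuleCat.{u} Λᵐᵒᵖ) [Module.Finite Λᵐᵒᵖ M] :
    ∃ (I : ModuleCat.{u} Λᵐᵒᵖ) (f : M ⟶ I), Module.Finite Λᵐᵒᵖ I ∧ IsInjectiveEnvelope f := by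
  have := isArtinianRing_of_finiteDimensional k (R := Λᵐᵒᵖ)
  have := finiteDimensional_of_finite k M
  have := dualLeft_self_injective k (Λ := Λ)
  let := dualLeftModule k (leftRegular Λ)
  let b := Module.finBasis k M
  let n := Module.finrank k M
  let ι : M →ₗ[Λᵐᵒᵖ] (Fin n → dualLeft k (leftRegular Λ)) := LinearMap.pi fun j =>
    show M →ₗ[Λᵐᵒᵖ] LeftForms k (leftRegular Λ) from
    { toFun := fun m =>
        { toFun := fun a => b.coord j (MulOpposite.op (show Λ from a) • m)
          map_add' := fun a b => by
            rw [← map_add, ← add_smul]; rfl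
          map_smul' := fun c a => by
            rw [RingHom.id_apply, ← map_smul, ← smul_assoc]
            congr 2
            exact congrArg MulOpposite.op (algebraMap_smul Λ c (show Λ from a)) }
      map_add' := fun y z => by
        ext a
        change b.coord j (_ • (y + z)) = b.coord j _ + b.coord j _
        rw [smul_add, map_add]
      map_smul' := fun c y => by
        ext a
        change b.coord j (MulOpposite.op (show Λ from a) • c • y) =
          b.coord j (MulOpposite.op (c.unop * (show Λ from a)) • y)
        rw [← mul_smul]
        rfl }
  refine exists_injectiveEnvelope M ⟨ModuleCat.of Λᵐᵒᵖ (Fin n → dualLeft k (leftRegular Λ)),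
    ModuleCat.ofHom ι, inferInstanceAs (Module.Finite Λᵐᵒᵖ (Fin n → _)),
    inferInstanceAs (Module.Injective Λᵐᵒᵖ (Fin n → _)), ?_⟩
  change Function.Injective ι
  rw [← LinearMap.ker_eq_bot, LinearMap.ker_eq_bot']
  intro m hm
  refine b.ext_elem fun j => ?_
  have h1 : b.coord j (MulOpposite.op (1 : Λ) • m) = 0 :=
    LinearMap.congr_fun (f := (show LeftForms k (leftRegular Λ) from ι m j)) (g := 0)
      (congrFun hm j) (1 : Λ)
  rw [MulOpposite.op_one, one_smul] at h1
  simpa using h1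

/-- The injective envelope of a finitely generated right module. -/
def injectiveEnvelope (M : ModuleCat.{u} Λᵐᵒᵖ) [Module.Finite Λᵐᵒᵖ M] : ModuleCat.{u} Λᵐᵒᵖ :=
  (exists_injectiveEnvelope_right k M).choose

def injectiveEnvelopeMap (M : ModuleCat.{u} Λᵐᵒᵖ) [Module.Finite Λᵐᵒᵖ M] :
    M ⟶ injectiveEnvelope k M :=
  (exists_injectiveEnvelope_right k M).choose_spec.choose

instance (M : ModuleCat.{u} Λᵐᵒᵖ) [Module.Finite Λᵐᵒᵖ M] :
    Module.Finite Λᵐᵒᵖ (injectiveEnvelope k M) :=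
  (exists_injectiveEnvelope_right k M).choose_spec.choose_spec.1

theorem isInjectiveEnvelope_injectiveEnvelopeMap (M : ModuleCat.{u} Λᵐᵒᵖ)
    [Module.Finite Λᵐᵒᵖ M] : IsInjectiveEnvelope (injectiveEnvelopeMap k M) :=
  (exists_injectiveEnvelope_right k M).choose_spec.choose_spec.2

/-- The first cosyzygy `Ω⁻¹ M`: the cokernel of the injective envelope of `M`. -/
def cosyzygy (M : ModuleCat.{u} Λᵐᵒᵖ) [Module.Finite Λᵐᵒᵖ M] : ModuleCat.{u} Λᵐᵒᵖ :=
  ModuleCat.of Λᵐᵒᵖ (injectiveEnvelope k M ⧸ LinearMap.range (injectiveEnvelopeMap k M).hom)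

instance (M : ModuleCat.{u} Λᵐᵒᵖ) [Module.Finite Λᵐᵒᵖ M] : Module.Finite Λᵐᵒᵖ (cosyzygy k M) :=
  inferInstanceAs (Module.Finite Λᵐᵒᵖ
    (injectiveEnvelope k M ⧸ LinearMap.range (injectiveEnvelopeMap k M).hom))

/-- `M` is `τ_Λ`-rigid: `Hom_Λ(M, τ M) = 0`. -/
def IsTauRigid (M : ModuleCat.{u} Λᵐᵒᵖ) [Module.Finite Λᵐᵒᵖ M] : Prop :=
  ∀ g : M ⟶ tau k M, g = 0

end FiniteDimensional

end Translations

/-! ### Generated modules, homological dimensions, partial tilting modules -/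

section ModuleClasses

variable {R : Type u} [Ring R]

/-- `X` is a finitely generated module lying in `Gen M`: there is an epimorphism `M ^ d → X` for
some `d ≥ 0`. -/
def InGen (M X : ModuleCat.{u} R) : Prop :=
  Module.Finite R X ∧ ∃ (d : ℕ) (p : (Fin d → M) →ₗ[R] X), Function.Surjective p

/-- Every finitely generated module has projective dimension at most `n`. -/
def GlobalDimensionLE (R : Type u) [Ring R] (n : ℕ) : Prop :=
  ∀ X : ModuleCat.{u} R, Module.Finite R X → HasProjectiveDimensionLE X n

/-- `M` is partial tilting: `pd M ≤ 1` and `Ext¹(M, M) = 0`. -/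
def IsPartialTilting (M : ModuleCat.{u} R) : Prop :=
  HasProjectiveDimensionLE M 1 ∧ ∀ e : Abelian.Ext.{u} M M 1, e = 0

end ModuleClasses

/-! ### The relation extension -/

section RelationExtension

attribute [local instance] ModuleCat.moduleOfAlgebraModule
attribute [local instance] ModuleCat.isScalarTower_of_algebra_moduleCat

variable (k : Type u) [Field k] (C : Type u) [Ring C] [Algebra k C]

/-- Left multiplication by `c` on `C`, as an endomorphism of the right module `C`. -/
def leftMul (c : C) : rightRegular C ⟶ rightRegular C :=
  ModuleCat.ofHom (R := Cᵐᵒᵖ) (X := C) (Y := C)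
    { toFun := fun x => c * x
      map_add' := mul_add c
      map_smul' := fun a x => (mul_assoc c x a.unop).symm }

/-- Right multiplication by `c` on `C`, as an endomorphism of the left module `C`. -/
def rightMul (c : C) : leftRegular C ⟶ leftRegular C :=
  ModuleCat.ofHom (R := C) (X := C) (Y := C)
    { toFun := fun x => x * c
      map_add' := fun x y => add_mul x y c
      map_smul' := fun a x => mul_assoc a x c }

/-- `DC = Hom_k(C, k)` as a right `C`-module. -/
abbrev dualAlgebra : ModuleCat.{u} Cᵐᵒᵖ := dualLeft k (leftRegular C)

/-- The left action `f ↦ c • f` on `DC`, `(c • f) x = f (x c)`, as an endomorphism of the right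
module `DC`. -/
def leftMulDual (c : C) : dualAlgebra k C ⟶ dualAlgebra k C := dualLeftMap k (rightMul C c)

theorem leftMul_one : leftMul C 1 = 𝟙 _ := ModuleCat.hom_ext (LinearMap.ext fun x : C => one_mul x)

theorem leftMul_zero : leftMul C 0 = 0 := ModuleCat.hom_ext (LinearMap.ext fun x : C => zero_mul x)

theorem leftMul_add (c d : C) : leftMul C (c + d) = leftMul C c + leftMul C d := ModuleCat.hom_ext (LinearMap.ext fun x : C => add_mul c d x)

theorem leftMul_mul (c d : C) : leftMul C (c * d) = leftMul C d ≫ leftMul C c := ModuleCat.hom_ext (LinearMap.ext fun x : C => mul_assoc c d x)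

theorem leftMul_smul (a : k) : leftMul C (algebraMap k C a) = a • 𝟙 _ := ModuleCat.hom_ext (LinearMap.ext fun x : C => by
    change algebraMap k C a * x = x * algebraMap k C a
    exact Algebra.commutes a x)

theorem leftMulDual_apply (c : C) (f : LeftForms k (leftRegular C)) (x : C) :
    (show LeftForms k (leftRegular C) from leftMulDual k C c f) x = f (x * c) := rfl

theorem dualAlgebra_hom_ext {h h' : dualAlgebra k C ⟶ dualAlgebra k C}
    (H : ∀ (f : LeftForms k (leftRegular C)) (x : C),
      (show LeftForms k (leftRegular C) from h f) x =
        (show LeftForms k (leftRegular C) from h' f) x) : h = h' := by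
  refine ModuleCat.hom_ext (LinearMap.ext fun f => ?_)
  exact LinearMap.ext (H f)

theorem leftMulDual_one : leftMulDual k C 1 = 𝟙 _ :=
  dualAlgebra_hom_ext k C fun f x => congrArg f (mul_one x)

theorem leftMulDual_zero : leftMulDual k C 0 = 0 :=
  dualAlgebra_hom_ext k C fun f x => (congrArg f (mul_zero x)).trans (map_zero f)

theorem leftMulDual_add (c d : C) :
    leftMulDual k C (c + d) = leftMulDual k C c + leftMulDual k C d :=
  dualAlgebra_hom_ext k C fun f x => (congrArg f (mul_add x c d)).trans (map_add f _ _)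

theorem leftMulDual_mul (c d : C) :
    leftMulDual k C (c * d) = leftMulDual k C d ≫ leftMulDual k C c :=
  dualAlgebra_hom_ext k C fun f x => congrArg f (mul_assoc x c d).symm

theorem leftMulDual_smul (a : k) : leftMulDual k C (algebraMap k C a) = a • 𝟙 _ :=
  dualAlgebra_hom_ext k C fun f x => by
    change f (x * algebraMap k C a) = f (algebraMap k C a * x)
    rw [Algebra.commutes]

/-- The bimodule `E = Ext²_C(DC, C)`, the extensions being taken in right modules. -/
def relExtBimodule : Type u :=
  Abelian.Ext.{u} (dualAlgebra k C) (rightRegular C) 2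

instance : AddCommGroup (relExtBimodule k C) :=
  inferInstanceAs (AddCommGroup (Abelian.Ext.{u} (dualAlgebra k C) (rightRegular C) 2))

instance : Module k (relExtBimodule k C) :=
  inferInstanceAs (Module k (Abelian.Ext.{u} (dualAlgebra k C) (rightRegular C) 2))

open Abelian in
/-- `C` acts on the left of `E` through its left action on the right module `C`. -/
instance : Module C (relExtBimodule k C) where
  smul c e := Ext.comp (show Ext _ _ 2 from e) (Ext.mk₀ (leftMul C c)) (add_zero 2)
  one_smul e := by
    change Ext.comp _ (Ext.mk₀ (leftMul C 1)) _ = e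
    rw [leftMul_one]
    exact Ext.comp_mk₀_id _
  mul_smul c d e := by
    change Ext.comp _ (Ext.mk₀ (leftMul C (c * d))) _ =
      Ext.comp (Ext.comp _ (Ext.mk₀ (leftMul C d)) _) (Ext.mk₀ (leftMul C c)) _
    rw [leftMul_mul, ← Ext.mk₀_comp_mk₀]
    exact (Ext.comp_assoc_of_third_deg_zero _ _ _ _).symm
  smul_zero c := by
    exact Ext.zero_comp (X := dualAlgebra k C) (n := 2)
      (Ext.mk₀ (leftMul C c)) _ (add_zero 2)
  smul_add c e e' := by exact Ext.add_comp _ _ _ _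
  add_smul c d e := by
    change Ext.comp _ (Ext.mk₀ (leftMul C (c + d))) _ = _
    rw [leftMul_add, Ext.mk₀_add]
    exact Ext.comp_add _ _ _ _
  zero_smul e := by
    change Ext.comp _ (Ext.mk₀ (leftMul C 0)) _ = _
    rw [leftMul_zero, Ext.mk₀_zero]
    exact Ext.comp_zero _ _ _ _ _

open Abelian in
/-- `C` acts on the right of `E` through its left action on the right module `DC`. -/
instance : Module Cᵐᵒᵖ (relExtBimodule k C) where
  smul c e := Ext.comp (Ext.mk₀ (leftMulDual k C c.unop)) (show Ext _ _ 2 from e) (zero_add 2)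
  one_smul e := by
    change Ext.comp (Ext.mk₀ (leftMulDual k C 1)) _ _ = e
    rw [leftMulDual_one]
    exact Ext.mk₀_id_comp _
  mul_smul c d e := by
    change Ext.comp (Ext.mk₀ (leftMulDual k C (d.unop * c.unop))) _ _ =
      Ext.comp (Ext.mk₀ (leftMulDual k C c.unop))
        (Ext.comp (Ext.mk₀ (leftMulDual k C d.unop)) _ _) _
    rw [leftMulDual_mul]
    exact (Ext.mk₀_comp_mk₀_assoc _ _ _).symm
  smul_zero c := by
    exact Ext.comp_zero (Ext.mk₀ (leftMulDual k C c.unop)) (rightRegular C) 2 2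
      (zero_add 2)
  smul_add c e e' := by exact Ext.comp_add _ _ _ _
  add_smul c d e := by
    change Ext.comp (Ext.mk₀ (leftMulDual k C (c.unop + d.unop))) _ _ = _
    rw [leftMulDual_add, Ext.mk₀_add]
    exact Ext.add_comp _ _ _ _
  zero_smul e := by
    change Ext.comp (Ext.mk₀ (leftMulDual k C 0)) _ _ = _
    rw [leftMulDual_zero, Ext.mk₀_zero]
    exact Ext.zero_comp (X := dualAlgebra k C) (n := 0)
      (show Ext (dualAlgebra k C) (rightRegular C) 2 from e) _ (zero_add 2)

open Abelian in
instance : SMulCommClass C Cᵐᵒᵖ (relExtBimodule k C) where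
  smul_comm c d e := by
    exact Ext.comp_assoc_of_third_deg_zero (Ext.mk₀ (leftMulDual k C d.unop))
      (show Ext (dualAlgebra k C) (rightRegular C) 2 from e) (Ext.mk₀ (leftMul C c)) (zero_add 2)

open Abelian in
instance : IsScalarTower k C (relExtBimodule k C) :=
  IsScalarTower.of_algebraMap_smul fun a e => by
    change Ext.comp _ (Ext.mk₀ (leftMul C (algebraMap k C a))) _ = _
    rw [leftMul_smul]
    exact (Ext.smul_eq_comp_mk₀ _ a).symm

open Abelian in
instance : IsScalarTower k Cᵐᵒᵖ (relExtBimodule k C) :=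
  IsScalarTower.of_algebraMap_smul fun a e => by
    change Ext.comp (Ext.mk₀ (leftMulDual k C (algebraMap k C a))) _ _ = _
    rw [leftMulDual_smul, Ext.mk₀_smul, Ext.smul_comp]
    exact congrArg (a • ·) (Ext.mk₀_id_comp _)

theorem finiteDimensional_ext {R : Type u} [Ring R] [Algebra k R] [FiniteDimensional k R]
    (N M : ModuleCat.{u} R) [Module.Finite R N] [Module.Finite R M] (i : ℕ) :
    Module.Finite k (Abelian.Ext.{u} N M i) := by
  have := isArtinianRing_of_finiteDimensional k (R := R)
  induction i generalizing N with
  | zero =>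
    have := finiteDimensional_of_finite k N
    have := finiteDimensional_of_finite k M
    have : Module.Finite k (N →ₗ[R] M) :=
      Module.Finite.of_injective (LinearMap.restrictScalarsₗ k R N M k)
        (LinearMap.restrictScalars_injective k)
    exact Module.Finite.equiv
      ((Abelian.Ext.linearEquiv₀ (R := k)).trans (ModuleCat.homLinearEquiv (S := k))).symm
  | succ n ih =>
    obtain ⟨m, f, surjf⟩ := Module.Finite.exists_fin' R N
    let exac := LinearMap.shortExact_shortComplexKer surjf
    have : Module.Finite R f.shortComplexKer.X₁ :=
      inferInstanceAs (Module.Finite R (LinearMap.ker f))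
    have : Projective f.shortComplexKer.X₂ :=
      inferInstanceAs (Projective (ModuleCat.of R (Fin m → R)))
    have := ih f.shortComplexKer.X₁
    exact Module.Finite.of_surjective (exac.extClass.precompOfLinear k M (add_comm 1 n))
      (precomp_extClass_surjective_of_projective_X₂ M exac n)

instance [FiniteDimensional k C] : FiniteDimensional k (relExtBimodule k C) :=
  finiteDimensional_ext k (dualAlgebra k C) (rightRegular C) 2

/-- The relation extension `B = C ⋉ E`: the trivial extension, with multiplication
`(c, e) (c', e') = (c c', c e' + e c')`. -/
abbrev RelationExtension : Type u := TrivSqZeroExt C (relExtBimodule k C)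

instance [FiniteDimensional k C] : FiniteDimensional k (RelationExtension k C) :=
  inferInstanceAs (Module.Finite k (C × relExtBimodule k C))

variable {C}

/-- A right `C`-module viewed as a right `B`-module: `m (c, e) = m c`. -/
def toRelationExtension (M : ModuleCat.{u} Cᵐᵒᵖ) : ModuleCat.{u} (RelationExtension k C)ᵐᵒᵖ :=
  (ModuleCat.restrictScalars
    (RingHom.op (TrivSqZeroExt.fstHom k C (relExtBimodule k C)).toRingHom)).obj M

instance (M : ModuleCat.{u} Cᵐᵒᵖ) [Module.Finite Cᵐᵒᵖ M] :
    Module.Finite (RelationExtension k C)ᵐᵒᵖ (toRelationExtension k M) := by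
  obtain ⟨S, hS⟩ := (inferInstance : Module.Finite Cᵐᵒᵖ M).fg_top
  let N := Submodule.span (RelationExtension k C)ᵐᵒᵖ
    (show Set (toRelationExtension k M) from (S : Set M))
  have key : ∀ m : M, m ∈ Submodule.span Cᵐᵒᵖ (S : Set M) →
      (show toRelationExtension k M from m) ∈ N := by
    intro m hm
    induction hm using Submodule.span_induction with
    | mem x hx => exact Submodule.subset_span (R := (RelationExtension k C)ᵐᵒᵖ) hx
    | zero => exact N.zero_mem
    | add x y _ _ hx hy => exact N.add_mem hx hy
    | smul a x _ hx => exact N.smul_mem (MulOpposite.op (TrivSqZeroExt.inl a.unop)) hx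
  exact ⟨⟨show Finset (toRelationExtension k M) from S,
    Submodule.eq_top_iff'.mpr fun m => key m (hS ▸ Submodule.mem_top)⟩⟩

end RelationExtension

end

end RelExt

namespace RelExt

noncomputable section

/-! ### Consequences of the long exact sequences of `Ext` -/

section Homological

open Abelian ShortComplex

variable {R : Type u} [Ring R]

/-! By Auslander–Smalø, `M` is τ-rigid exactly when Ext¹(M, X) = 0 for every quotient X of M
(`isTauRigid_iff_extendsFromKernels`), so the question is one about extensions. Let 0 → X → Z → M →
0 be an extension of B-modules with X a quotient of M. Since E kills both X and M, its action on Z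
amounts to a morphism M ⊗ E → X of C-modules. If that morphism is zero, Z is a C-module and the
sequence splits because M is τ_C-rigid. Hence a τ_C-rigid M is τ_B-rigid as soon as Hom_C(M ⊗ E, X)
= 0 for all its quotients X (`isTauRigid_toRelationExtension`), and by right exactness of the tensor
product it suffices that Hom_C(P₀ ⊗ E, X) = 0.

Now P₀ ⊗ E is Ext²(DC, P₀). As Ext³ vanishes, Ext²(-, P₀) is right exact; applying it to a
copresentation of X by powers of DC, a trace argument shows that Ext²(X, P₀) = 0 forces Hom_C(P₀ ⊗
E, X) = 0 (`balancedVanish_of_ext_two`). Since Ω⁻¹P₀ has injective dimension at most one, the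
Auslander–Reiten formula translates Ext²(X, P₀) = Ext¹(X, Ω⁻¹P₀) = 0 into Hom(τ⁻¹Ω⁻¹P₀, X) = 0
(`hom_tauInv_cosyzygy_eq_zero_iff`). Both translations are handled by the Nakayama pairing D Hom(P,
X) ≅ Hom(X, DQ) for a dual pair of projectives P, Q.

This gives the first criterion. In the second, pd X ≤ 1 kills Ext²(X, P₀) directly. In the third, a
nonzero map P₀ ⊗ E → X would produce a B-extension of P₀ by its quotient X that contradicts
τ_B-rigidity of P₀ (`balancedVanish_of_isTauRigid`). In the fourth, pd M ≤ 1 gives Hom(τ⁻¹Ω⁻¹P₀, M)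
= 0, and the hypothesis on the syzygy lets every map from τ⁻¹Ω⁻¹P₀ to a quotient of M lift to M, so
it vanishes too. -/

theorem exists_extension_of_ext_one {S : ShortComplex (ModuleCat.{u} R)} (hS : S.ShortExact)
    {Y : ModuleCat.{u} R} [Subsingleton (Ext.{u} S.X₃ Y 1)] (f : S.X₁ ⟶ Y) :
    ∃ g : S.X₂ ⟶ Y, S.f ≫ g = f := by
  obtain ⟨x, hx⟩ := Ext.contravariant_sequence_exact₁ hS Y (Ext.mk₀ f) (add_zero 1)
    (Subsingleton.elim _ _)
  obtain ⟨g, rfl⟩ := Ext.addEquiv₀.symm.surjective x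
  exact ⟨g, Ext.mk₀_bijective _ _ |>.injective (by simpa using hx)⟩

theorem exists_lift_of_ext_one {S : ShortComplex (ModuleCat.{u} R)} (hS : S.ShortExact)
    {X : ModuleCat.{u} R} [Subsingleton (Ext.{u} X S.X₁ 1)] (f : X ⟶ S.X₃) :
    ∃ g : X ⟶ S.X₂, g ≫ S.g = f := by
  obtain ⟨x, hx⟩ := Ext.covariant_sequence_exact₃ X hS (Ext.mk₀ f) (zero_add 1)
    (Subsingleton.elim _ _)
  obtain ⟨g, rfl⟩ := Ext.addEquiv₀.symm.surjective x
  exact ⟨g, Ext.mk₀_bijective _ _ |>.injective (by simpa using hx)⟩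

/-- Every class in Ext¹(X, S.X₁) is the connecting image of a map X → S.X₃, and the connecting map
kills the maps that lift to S.X₂. -/
theorem subsingleton_ext_one_of_lift {S : ShortComplex (ModuleCat.{u} R)} (hS : S.ShortExact)
    {X : ModuleCat.{u} R} [Subsingleton (Ext.{u} X S.X₂ 1)]
    (h : ∀ f : X ⟶ S.X₃, ∃ g : X ⟶ S.X₂, g ≫ S.g = f) : Subsingleton (Ext.{u} X S.X₁ 1) := by
  refine subsingleton_of_forall_eq 0 fun e => ?_
  obtain ⟨x, rfl⟩ := Ext.covariant_sequence_exact₁ X hS e (Subsingleton.elim _ _) (zero_add 1)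
  obtain ⟨f, rfl⟩ := Ext.addEquiv₀.symm.surjective x
  obtain ⟨g, rfl⟩ := h f
  change (Ext.mk₀ (g ≫ S.g)).comp hS.extClass _ = 0
  rw [← Ext.mk₀_comp_mk₀, Ext.comp_assoc _ _ _ (zero_add 0) (zero_add 1) (by simp),
    hS.comp_extClass, Ext.comp_zero]

/-- Dimension shifting along the covariant long exact sequence; used with an injective middle term.
-/
theorem subsingleton_ext_X₁ {S : ShortComplex (ModuleCat.{u} R)} (hS : S.ShortExact)
    (X : ModuleCat.{u} R) (n : ℕ) [Subsingleton (Ext.{u} X S.X₃ n)]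
    [Subsingleton (Ext.{u} X S.X₂ (n + 1))] : Subsingleton (Ext.{u} X S.X₁ (n + 1)) := by
  refine subsingleton_of_forall_eq 0 fun e => ?_
  obtain ⟨x, rfl⟩ := Ext.covariant_sequence_exact₁ X hS e (Subsingleton.elim _ _) rfl
  rw [Subsingleton.elim x 0, Ext.zero_comp]

theorem subsingleton_ext_X₃ {S : ShortComplex (ModuleCat.{u} R)} (hS : S.ShortExact)
    (X : ModuleCat.{u} R) (n : ℕ) [Subsingleton (Ext.{u} X S.X₂ n)]
    [Subsingleton (Ext.{u} X S.X₁ (n + 1))] : Subsingleton (Ext.{u} X S.X₃ n) := by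
  refine subsingleton_of_forall_eq 0 fun e => ?_
  obtain ⟨x, rfl⟩ := Ext.covariant_sequence_exact₃ X hS e rfl (Subsingleton.elim _ _)
  rw [Subsingleton.elim x 0, Ext.zero_comp]

theorem subsingleton_ext_of_iso (X : ModuleCat.{u} R) {Y Y' : ModuleCat.{u} R} (i : Y ≅ Y')
    (n : ℕ) [Subsingleton (Ext.{u} X Y' n)] : Subsingleton (Ext.{u} X Y n) := by
  refine subsingleton_of_forall_eq 0 fun e => ?_
  rw [← Ext.comp_mk₀_id e, ← i.hom_inv_id, ← Ext.mk₀_comp_mk₀,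
    ← Ext.comp_assoc_of_third_deg_zero, Subsingleton.elim (e.comp (Ext.mk₀ i.hom) _) 0,
    Ext.zero_comp]

/-- The obstruction to extending a class along `S.f` is its connecting image in Extⁿ⁺¹(S.X₃, Y). -/
theorem exists_precomp_eq_of_shortExact_X₁ {S : ShortComplex (ModuleCat.{u} R)}
    (hS : S.ShortExact) {Y : ModuleCat.{u} R} {n : ℕ} [Subsingleton (Ext.{u} S.X₃ Y (1 + n))]
    (e : Ext.{u} S.X₁ Y n) : ∃ e' : Ext.{u} S.X₂ Y n, (Ext.mk₀ S.f).comp e' (zero_add n) = e :=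
  Ext.contravariant_sequence_exact₁ hS Y e rfl (Subsingleton.elim _ _)

/-- If `0 → X → J → J'` is exact, `Extⁿ(X, Y) = 0` and `Extⁿ⁺¹(-, Y)` vanishes on the cokernel of
`J → J'`, then `Extⁿ(J', Y) → Extⁿ(J, Y)` is surjective. -/
theorem exists_precomp_eq_of_exact {X J J' Y : ModuleCat.{u} R} (i : X ⟶ J) (a : J ⟶ J')
    (hi : Function.Injective i) (hia : Function.Exact i a) {n : ℕ}
    [Subsingleton (Ext.{u} X Y n)]
    [Subsingleton (Ext.{u} (ModuleCat.of R (J' ⧸ LinearMap.range a.hom)) Y (1 + n))]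
    (e : Ext.{u} J Y n) : ∃ e' : Ext.{u} J' Y n, (Ext.mk₀ a).comp e' (zero_add n) = e := by
  -- Factor a through its image: the vanishing of Extⁿ(X, Y) moves the class from J to the image,
  -- that of Extⁿ⁺¹ on the cokernel moves it on to J'.
  let Z := ModuleCat.of R (LinearMap.range a.hom)
  let p : J ⟶ Z := ModuleCat.ofHom a.hom.rangeRestrict
  let j : Z ⟶ J' := ModuleCat.ofHom (LinearMap.range a.hom).subtype
  let W := ModuleCat.of R (J' ⧸ LinearMap.range a.hom)
  let q : J' ⟶ W := ModuleCat.ofHom (LinearMap.range a.hom).mkQ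
  have hip : Function.Exact i p := by
    intro x
    rw [← hia x]
    exact Subtype.ext_iff
  have hS₁ : (ShortComplex.mk i p (ModuleCat.hom_ext (LinearMap.ext fun x =>
      (hip _).mpr ⟨x, rfl⟩))).ShortExact :=
    ModuleCat.shortComplex_shortExact _ hip hi (LinearMap.surjective_rangeRestrict _)
  have hjq : Function.Exact j q := LinearMap.exact_subtype_mkQ _
  have hS₂ : (ShortComplex.mk j q (ModuleCat.hom_ext (LinearMap.ext fun x =>
      (hjq _).mpr ⟨x, rfl⟩))).ShortExact :=
    ModuleCat.shortComplex_shortExact _ hjq (Submodule.injective_subtype _)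
      (Submodule.mkQ_surjective _)
  obtain ⟨z, rfl⟩ := Ext.contravariant_sequence_exact₂ hS₁ Y e (Subsingleton.elim _ _)
  obtain ⟨e', rfl⟩ := exists_precomp_eq_of_shortExact_X₁ hS₂ z
  exact ⟨e', (Ext.mk₀_comp_mk₀_assoc p j e').symm⟩

/-! ### Extending maps from kernels of epimorphisms -/

/-- Every map from the kernel of an epimorphism `Z → M` to `X` extends to `Z`; equivalently,
`Ext¹(M, X) = 0`. -/
def ExtendsFromKernels (M X : ModuleCat.{u} R) : Prop :=
  ∀ (Z : ModuleCat.{u} R) (p : Z →ₗ[R] M), Function.Surjective p →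
    ∀ f : LinearMap.ker p →ₗ[R] X, ∃ g : Z →ₗ[R] X, ∀ x : LinearMap.ker p, g x = f x

theorem extendsFromKernels_of_ext_one (M X : ModuleCat.{u} R) [Subsingleton (Ext.{u} M X 1)] :
    ExtendsFromKernels M X := by
  intro Z p hp f
  obtain ⟨g, hg⟩ := exists_extension_of_ext_one (LinearMap.shortExact_shortComplexKer hp)
    (Y := X) (ModuleCat.ofHom f)
  exact ⟨g.hom, fun x => LinearMap.congr_fun (congrArg ModuleCat.Hom.hom hg) x⟩

/-- One projective presentation suffices: any Z over M is the pushout of P along the induced map ker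
p → ker z. -/
theorem extendsFromKernels_of_projective {M X P : ModuleCat.{u} R} [Module.Projective R P]
    (p : P →ₗ[R] M) (hp : Function.Surjective p)
    (h : ∀ f : LinearMap.ker p →ₗ[R] X, ∃ g : P →ₗ[R] X, ∀ x : LinearMap.ker p, g x = f x) :
    ExtendsFromKernels M X := by
  intro Z z hz f
  obtain ⟨l, hl⟩ := Module.projective_lifting_property z p hz
  have hl' : ∀ x, z (l x) = p x := LinearMap.congr_fun hl
  have hmem : ∀ x : LinearMap.ker p, (l ∘ₗ (LinearMap.ker p).subtype) x ∈ LinearMap.ker z :=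
    fun x => (hl' x).trans x.2
  obtain ⟨w, hw⟩ := h (f ∘ₗ (l ∘ₗ (LinearMap.ker p).subtype).codRestrict _ hmem)
  -- `s` presents Z as a quotient of P × ker z; `t` kills its kernel because w and f agree on ker p,
  -- so `t` descends to the wanted extension.
  let s : (P × LinearMap.ker z) →ₗ[R] Z := l.coprod (LinearMap.ker z).subtype
  let t : (P × LinearMap.ker z) →ₗ[R] X := w.coprod f
  have hs : Function.Surjective s := by
    intro y
    obtain ⟨x, hx⟩ := hp (z y)
    refine ⟨(x, ⟨y - l x, ?_⟩), ?_⟩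
    · rw [LinearMap.mem_ker, map_sub, hl', hx, sub_self]
    · simp [s]
  have hst : LinearMap.ker s ≤ LinearMap.ker t := by
    rintro ⟨x, y⟩ hxy
    have h1 : l x + y = 0 := hxy
    have h2 : x ∈ LinearMap.ker p := by
      rw [LinearMap.mem_ker, ← hl', eq_neg_of_add_eq_zero_left h1, map_neg,
        LinearMap.mem_ker.mp y.2, neg_zero]
    have h3 : w x + f y = 0 := by
      rw [hw ⟨x, h2⟩, LinearMap.comp_apply, ← map_add]
      convert map_zero f
      exact Subtype.ext h1
    exact h3
  refine ⟨(LinearMap.ker s).liftQ t hst ∘ₗ (s.quotKerEquivOfSurjective hs).symm.toLinearMap,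
    fun y => ?_⟩
  have h4 : (s.quotKerEquivOfSurjective hs).symm (y : Z) = (LinearMap.ker s).mkQ (0, y) := by
    rw [LinearEquiv.symm_apply_eq]
    exact (by simp [s] : s (0, y) = y).symm
  rw [LinearMap.comp_apply, LinearEquiv.coe_coe, h4]
  simp [t]

end Homological

/-! ### The standard duality -/

section Duality

attribute [local instance] ModuleCat.moduleOfAlgebraModule
attribute [local instance] ModuleCat.isScalarTower_of_algebra_moduleCat

variable (k : Type u) [Field k] {Λ : Type u} [Ring Λ] [Algebra k Λ]

/-- The linear form underlying an element of `D N`. -/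
def toForm {N : ModuleCat.{u} Λ} : dualLeft k N →+ LeftForms k N := AddMonoidHom.id _

theorem toForm_injective {N : ModuleCat.{u} Λ} :
    Function.Injective (toForm k : dualLeft k N → LeftForms k N) := fun _ _ h => h

theorem toForm_smul {N : ModuleCat.{u} Λ} (a : Λᵐᵒᵖ) (f : dualLeft k N) (y : N) :
    toForm k (a • f) y = toForm k f (a.unop • y) := rfl

theorem toForm_dualLeftMap {N N' : ModuleCat.{u} Λ} (h : N ⟶ N') (f : dualLeft k N') (y : N) :
    toForm k (dualLeftMap k h f) y = toForm k f (h y) := rfl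

/-- A morphism to `D N` given by a family of linear forms that is balanced over `Λ`. -/
def homDual {X : ModuleCat.{u} Λᵐᵒᵖ} {N : ModuleCat.{u} Λ} (b : X →+ LeftForms k N)
    (hb : ∀ (a : Λᵐᵒᵖ) (x : X) (y : N), b (a • x) y = b x (a.unop • y)) : X ⟶ dualLeft k N :=
  ModuleCat.ofHom (Y := dualLeft k N)
    { toFun := fun x => show dualLeft k N from b x
      map_add' := b.map_add
      map_smul' := fun a x => toForm_injective k (LinearMap.ext fun y => hb a x y) }

theorem smul_eq_algebraMap_smul {R : Type u} [Ring R] [Algebra k R] {X : ModuleCat.{u} R}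
    (c : k) (x : X) : c • x = algebraMap k R c • x := (algebraMap_smul R c x).symm

theorem toForm_hom_smul {X : ModuleCat.{u} Λᵐᵒᵖ} {N : ModuleCat.{u} Λ}
    (h : X ⟶ dualLeft k N) (c : k) (x : X) : toForm k (h (c • x)) = c • toForm k (h x) := by
  ext y
  rw [smul_eq_algebraMap_smul, map_smul, toForm_smul, LinearMap.smul_apply, ← map_smul]
  exact congrArg _ (algebraMap_smul Λ c y)

theorem dualLeftMap_injective {N N' : ModuleCat.{u} Λ} (p : N ⟶ N')
    (hp : Function.Surjective p) : Function.Injective (dualLeftMap k p) := by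
  intro f g hfg
  refine toForm_injective k (LinearMap.ext fun y => ?_)
  obtain ⟨x, rfl⟩ := hp y
  rw [← toForm_dualLeftMap, ← toForm_dualLeftMap, hfg]

/-- A linear form extends along any k-linear retraction, so no splitting over Λ is needed. -/
theorem dualLeftMap_surjective {N N' : ModuleCat.{u} Λ} (i : N ⟶ N')
    (hi : Function.Injective i) : Function.Surjective (dualLeftMap k i) := by
  intro f
  obtain ⟨r, hr⟩ := (i.hom.restrictScalars k).exists_leftInverse_of_injective
    (LinearMap.ker_eq_bot.mpr hi)
  refine ⟨show dualLeft k N' from toForm k f ∘ₗ r, toForm_injective k (LinearMap.ext fun y => ?_)⟩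
  exact congrArg (toForm k f) (LinearMap.congr_fun hr y)

theorem comp_dualLeftMap_eq_zero_iff {N N' : ModuleCat.{u} Λ} (f : N ⟶ N')
    {X : ModuleCat.{u} Λᵐᵒᵖ} (h : X ⟶ dualLeft k N') :
    h ≫ dualLeftMap k f = 0 ↔ ∀ x y, toForm k (h x) (f y) = 0 :=
  ⟨fun H x y => LinearMap.congr_fun (congrArg (toForm k)
      (LinearMap.congr_fun (congrArg ModuleCat.Hom.hom H) x)) y,
    fun H => ModuleCat.hom_ext (LinearMap.ext fun x =>
      toForm_injective k (LinearMap.ext fun y => H x y))⟩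

/-- A morphism to `D N` whose values vanish on the kernel of an epimorphism `N → N'` factors
through `D N'`. -/
theorem exists_comp_dualLeftMap_eq {N N' : ModuleCat.{u} Λ} (p : N ⟶ N')
    (hp : Function.Surjective p) {X : ModuleCat.{u} Λᵐᵒᵖ} (h : X ⟶ dualLeft k N)
    (hh : ∀ x y, p y = 0 → toForm k (h x) y = 0) :
    ∃ g : X ⟶ dualLeft k N', g ≫ dualLeftMap k p = h := by
  -- The section is only k-linear; `hh` makes the values independent of the chosen preimages, which
  -- restores Λ-linearity.
  obtain ⟨s, hs⟩ := (p.hom.restrictScalars k).exists_rightInverse_of_surjective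
    (LinearMap.range_eq_top.mpr hp)
  have hs' : ∀ y, p (s y) = y := LinearMap.congr_fun hs
  have key : ∀ x y z, p y = p z → toForm k (h x) y = toForm k (h x) z := fun x y z hyz => by
    rw [← sub_eq_zero, ← map_sub]
    exact hh x _ (by rw [map_sub, hyz, sub_self])
  refine ⟨homDual k ⟨⟨fun x => toForm k (h x) ∘ₗ s, ?_⟩, fun x y => ?_⟩ fun a x y => ?_, ?_⟩
  · ext y; simp
  · ext y; simp
  · change toForm k (h (a • x)) (s y) = toForm k (h x) (s (a.unop • y))
    rw [map_smul, toForm_smul]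
    exact key _ _ _ (by rw [map_smul, hs', hs'])
  · ext x
    refine toForm_injective k (LinearMap.ext fun y => ?_)
    exact key x _ _ (hs' _)

theorem dualLeftMap_exact {N' N N'' : ModuleCat.{u} Λ} (i : N' ⟶ N) (p : N ⟶ N'')
    (hp : Function.Surjective p) (hip : Function.Exact i p) :
    Function.Exact (dualLeftMap k p) (dualLeftMap k i) := by
  obtain ⟨s, hs⟩ := (p.hom.restrictScalars k).exists_rightInverse_of_surjective
    (LinearMap.range_eq_top.mpr hp)
  have hs' : ∀ y, p (s y) = y := LinearMap.congr_fun hs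
  intro f
  constructor
  · intro hf
    refine ⟨show dualLeft k N'' from toForm k f ∘ₗ s,
      toForm_injective k (LinearMap.ext fun y => ?_)⟩
    obtain ⟨z, hz⟩ := (hip (s (p y) - y)).mp (by rw [map_sub, hs', sub_self])
    have h1 : toForm k f (s (p y) - y) = 0 := by
      rw [← hz, ← toForm_dualLeftMap, hf]
      rfl
    rw [map_sub, sub_eq_zero] at h1
    exact h1
  · rintro ⟨g, rfl⟩
    refine toForm_injective k (LinearMap.ext fun y => ?_)
    rw [toForm_dualLeftMap, toForm_dualLeftMap, (hip _).mpr ⟨y, rfl⟩]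
    exact map_zero _

theorem dualLeftMap_shortExact {N' N N'' : ModuleCat.{u} Λ} (i : N' ⟶ N) (p : N ⟶ N'')
    (hi : Function.Injective i) (hp : Function.Surjective p) (hip : Function.Exact i p) :
    (ShortComplex.mk (dualLeftMap k p) (dualLeftMap k i) (ModuleCat.hom_ext (LinearMap.ext
      fun f => (dualLeftMap_exact k i p hp hip _).mpr ⟨f, rfl⟩))).ShortExact :=
  ModuleCat.shortComplex_shortExact _ (dualLeftMap_exact k i p hp hip)
    (dualLeftMap_injective k p hp) (dualLeftMap_surjective k i hi)

/-- A finitely generated module is isomorphic to its double dual. -/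
theorem nonempty_iso_doubleDual [FiniteDimensional k Λ] (Y : ModuleCat.{u} Λᵐᵒᵖ)
    [Module.Finite Λᵐᵒᵖ Y] : Nonempty (Y ≅ dualLeft k (dualRight k Y)) := by
  have := finiteDimensional_of_finite k Y
  -- The k-action on D Y is defined through Λ and has to be matched with the pointwise one.
  have hsmul : ∀ (c : k) (f : dualRight k Y) (y : Y),
      (show Y →ₗ[k] k from c • f) y = c * (show Y →ₗ[k] k from f) y := fun c f y => by
    rw [smul_eq_algebraMap_smul]
    change (show Y →ₗ[k] k from f) (MulOpposite.op (algebraMap k Λ c) • y) = _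
    rw [← smul_eq_mul, ← map_smul, smul_eq_algebraMap_smul (c := c)]
    rfl
  let e : Y ⟶ dualLeft k (dualRight k Y) := homDual k
    { toFun := fun y =>
        { toFun := fun f => (show Y →ₗ[k] k from f) y
          map_add' := fun _ _ => rfl
          map_smul' := fun c f => hsmul c f y }
      map_zero' := by
        ext f; exact map_zero (show Y →ₗ[k] k from f)
      map_add' := fun x y => by
        ext f; exact map_add (show Y →ₗ[k] k from f) x y }
    (fun a x y => rfl)
  have he : ∀ y f, toForm k (e y) f = (show Y →ₗ[k] k from f) y := fun _ _ => rfl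
  have hbij : Function.Bijective e.hom := by
    constructor
    · rw [← LinearMap.ker_eq_bot, LinearMap.ker_eq_bot']
      intro y hy
      rw [← Module.forall_dual_apply_eq_zero_iff k]
      intro f
      rw [← he y f]
      exact LinearMap.congr_fun (congrArg (toForm k) hy) f
    · intro g
      let g' : Module.Dual k (Module.Dual k Y) :=
        { toFun := fun f => toForm k g (show dualRight k Y from f)
          map_add' := fun x y => (toForm k g).map_add _ _
          map_smul' := fun c f => by
            rw [RingHom.id_apply, ← map_smul]
            exact congrArg (toForm k g) (LinearMap.ext fun y => (hsmul c f y).symm) }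
      obtain ⟨y, hy⟩ := (Module.evalEquiv k Y).surjective g'
      exact ⟨y, toForm_injective k (LinearMap.ext fun f => LinearMap.congr_fun hy f)⟩
  exact ⟨(LinearEquiv.ofBijective e.hom hbij).toModuleIso⟩

end Duality

/-! ### Dual pairs of finitely generated projective modules and the Nakayama pairing -/

section DualPairs

attribute [local instance] ModuleCat.moduleOfAlgebraModule
attribute [local instance] ModuleCat.isScalarTower_of_algebra_moduleCat

/-- A right module `P` and a left module `Q` together with a pairing `Q × P → Λ` that admits finite
dual bases; thus `P` and `Q` are finitely generated projective, and are the `Λ`-duals of each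
other. -/
structure DualPair {Λ : Type u} [Ring Λ] (P : ModuleCat.{u} Λᵐᵒᵖ) (Q : ModuleCat.{u} Λ) where
  pair : Q →ₗ[Λ] (P →ₗ[Λᵐᵒᵖ] Λ)
  n : ℕ
  p : Fin n → P
  q : Fin n → Q
  sum_right : ∀ x : P, ∑ i, MulOpposite.op (pair (q i) x) • p i = x
  sum_left : ∀ y : Q, ∑ i, pair y (p i) • q i = y

variable {Λ : Type u} [Ring Λ]

/-- A dual basis of a finitely generated projective right module. -/
theorem exists_dualBasis_right (P : ModuleCat.{u} Λᵐᵒᵖ) [Module.Finite Λᵐᵒᵖ P]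
    [Module.Projective Λᵐᵒᵖ P] : ∃ (n : ℕ) (p : Fin n → P) (q : Fin n → (P →ₗ[Λᵐᵒᵖ] Λ)),
      ∀ x : P, ∑ i, MulOpposite.op (q i x) • p i = x := by
  obtain ⟨n, f, hf⟩ := Module.Finite.exists_fin' Λᵐᵒᵖ P
  obtain ⟨s, hs⟩ := Module.projective_lifting_property f LinearMap.id hf
  let un : Λᵐᵒᵖ →ₗ[Λᵐᵒᵖ] Λ :=
    { toFun := MulOpposite.unop
      map_add' := fun _ _ => rfl
      map_smul' := fun _ _ => rfl }
  refine ⟨n, fun i => f fun j => if i = j then 1 else 0, fun i => un ∘ₗ LinearMap.proj i ∘ₗ s,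
    fun x => ?_⟩
  have h1 : f (s x) = x := LinearMap.congr_fun hs x
  rw [LinearMap.pi_apply_eq_sum_univ f (s x)] at h1
  exact h1

/-- A dual basis of a finitely generated projective left module. -/
theorem exists_dualBasis_left (Q : ModuleCat.{u} Λ) [Module.Finite Λ Q]
    [Module.Projective Λ Q] : ∃ (n : ℕ) (q : Fin n → Q) (p : Fin n → (Q →ₗ[Λ] Λ)),
      ∀ y : Q, ∑ i, p i y • q i = y := by
  obtain ⟨n, f, hf⟩ := Module.Finite.exists_fin' Λ Q
  obtain ⟨s, hs⟩ := Module.projective_lifting_property f LinearMap.id hf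
  refine ⟨n, fun i => f fun j => if i = j then 1 else 0, fun i => LinearMap.proj i ∘ₗ s,
    fun x => ?_⟩
  have h1 : f (s x) = x := LinearMap.congr_fun hs x
  rw [LinearMap.pi_apply_eq_sum_univ f (s x)] at h1
  exact h1

theorem exists_dualPair_right (P : ModuleCat.{u} Λᵐᵒᵖ) [Module.Finite Λᵐᵒᵖ P]
    [Module.Projective Λᵐᵒᵖ P] :
    ∃ d : DualPair P (ModuleCat.of Λ (P →ₗ[Λᵐᵒᵖ] Λ)), d.pair = LinearMap.id := by
  obtain ⟨n, p, q, h⟩ := exists_dualBasis_right P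
  refine ⟨⟨LinearMap.id, n, p, q, h, fun y => LinearMap.ext fun x => ?_⟩, rfl⟩
  change (∑ i, y (p i) • q i) x = y x
  conv_rhs => rw [← h x, map_sum]
  rw [LinearMap.sum_apply]
  refine Finset.sum_congr rfl fun i _ => ?_
  rw [map_smul]
  rfl

theorem exists_dualPair_left (Q : ModuleCat.{u} Λ) [Module.Finite Λ Q]
    [Module.Projective Λ Q] :
    ∃ d : DualPair (ModuleCat.of Λᵐᵒᵖ (Q →ₗ[Λ] Λ)) Q, ∀ y f, d.pair y f = f y := by
  obtain ⟨n, q, p, h⟩ := exists_dualBasis_left Q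
  refine ⟨⟨{ toFun := fun y =>
              { toFun := fun f => f y
                map_add' := fun _ _ => rfl
                map_smul' := fun _ _ => rfl }
             map_add' := fun y z => LinearMap.ext fun f => map_add f y z
             map_smul' := fun a y => LinearMap.ext fun f => map_smul f a y },
    n, p, q, fun x => LinearMap.ext fun y => ?_, h⟩, fun _ _ => rfl⟩
  change (∑ i, MulOpposite.op (x (q i)) • p i) y = x y
  conv_rhs => rw [← h y, map_sum]
  rw [LinearMap.sum_apply]
  refine Finset.sum_congr rfl fun i _ => ?_
  rw [map_smul]
  rfl

namespace DualPair

variable {P : ModuleCat.{u} Λᵐᵒᵖ} {Q : ModuleCat.{u} Λ} (d : DualPair P Q)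

/-- The map `z ↦ x ⟨y, z⟩` of rank one. -/
def rankOne {X : ModuleCat.{u} Λᵐᵒᵖ} (x : X) (y : Q) : P →ₗ[Λᵐᵒᵖ] X where
  toFun z := MulOpposite.op (d.pair y z) • x
  map_add' z w := by rw [map_add, MulOpposite.op_add, add_smul]
  map_smul' a z := by
    rw [map_smul, RingHom.id_apply, ← mul_smul]
    rfl

/-- This is surjectivity of X ⊗ Q → Hom(P, X); a form on Hom(P, X) is therefore determined by its
values on rank-one maps. -/
theorem sum_rankOne {X : ModuleCat.{u} Λᵐᵒᵖ} (t : P →ₗ[Λᵐᵒᵖ] X) :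
    ∑ i, d.rankOne (t (d.p i)) (d.q i) = t := by
  ext z
  rw [LinearMap.sum_apply]
  conv_rhs => rw [← d.sum_right z, map_sum]
  exact Finset.sum_congr rfl fun i _ => (map_smul t _ _).symm

variable (k : Type u) [Field k] [Algebra k Λ]

/-- The Nakayama pairing `D Hom(P, X) → Hom(X, D Q)`. -/
def nakayama (X : ModuleCat.{u} Λᵐᵒᵖ) (l : Module.Dual k (P →ₗ[Λᵐᵒᵖ] X)) : X ⟶ dualLeft k Q :=
  homDual k
    { toFun := fun x =>
        { toFun := fun y => l (d.rankOne x y)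
          map_add' := fun y z => by
            rw [← map_add]
            congr 1
            ext w
            change MulOpposite.op (d.pair (y + z) w) • x = _
            rw [map_add, LinearMap.add_apply, MulOpposite.op_add, add_smul]
            rfl
          map_smul' := fun c y => by
            rw [RingHom.id_apply, ← map_smul]
            congr 1
            ext w
            change MulOpposite.op (d.pair (c • y) w) • x = c • MulOpposite.op (d.pair y w) • x
            rw [smul_eq_algebraMap_smul, smul_eq_algebraMap_smul, map_smul, ← mul_smul]
            change MulOpposite.op (algebraMap k Λ c * d.pair y w) • x = _
            rw [Algebra.commutes]
            rfl }
      map_zero' := by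
        ext y
        exact (congrArg l (show d.rankOne (0 : X) y = 0 from
          LinearMap.ext fun w => smul_zero _)).trans (map_zero l)
      map_add' := fun x x' => by
        ext y
        refine (congrArg l (?_ : _ = d.rankOne x y + d.rankOne x' y)).trans (map_add l _ _)
        ext w
        exact smul_add _ _ _ }
    (fun a x y => by
      refine congrArg l (LinearMap.ext fun w => ?_)
      change MulOpposite.op (d.pair y w) • a • x = MulOpposite.op (d.pair (a.unop • y) w) • x
      rw [map_smul, ← mul_smul]
      rfl)

theorem toForm_nakayama (X : ModuleCat.{u} Λᵐᵒᵖ) (l : Module.Dual k (P →ₗ[Λᵐᵒᵖ] X)) (x : X)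
    (y : Q) : toForm k (d.nakayama k X l x) y = l (d.rankOne x y) := rfl

theorem nakayama_injective (X : ModuleCat.{u} Λᵐᵒᵖ) : Function.Injective (d.nakayama k X) := by
  intro l l' h
  ext t
  rw [← d.sum_rankOne t, map_sum, map_sum]
  refine Finset.sum_congr rfl fun i _ => ?_
  rw [← toForm_nakayama, ← toForm_nakayama, h]

/-- A preimage of h is the trace form t ↦ ∑ h(t pᵢ)(qᵢ) attached to the dual bases. -/
theorem nakayama_surjective (X : ModuleCat.{u} Λᵐᵒᵖ) :
    Function.Surjective (d.nakayama k X) := by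
  intro h
  refine ⟨
    { toFun := fun t => ∑ i, toForm k (h (t (d.p i))) (d.q i)
      map_add' := fun t t' => by
        rw [← Finset.sum_add_distrib]
        refine Finset.sum_congr rfl fun i _ => ?_
        rw [LinearMap.add_apply, map_add, map_add, LinearMap.add_apply]
      map_smul' := fun c t => by
        rw [RingHom.id_apply, Finset.smul_sum]
        refine Finset.sum_congr rfl fun i _ => ?_
        rw [LinearMap.smul_apply, toForm_hom_smul, LinearMap.smul_apply] },
    ModuleCat.hom_ext (LinearMap.ext fun x => toForm_injective k (LinearMap.ext fun y => ?_))⟩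
  change ∑ i, toForm k (h (MulOpposite.op (d.pair y (d.p i)) • x)) (d.q i) = toForm k (h x) y
  conv_rhs => rw [← d.sum_left y, map_sum]
  refine Finset.sum_congr rfl fun i _ => ?_
  rw [map_smul, toForm_smul]
  rfl

theorem nakayama_zero (X : ModuleCat.{u} Λᵐᵒᵖ) : d.nakayama k X 0 = 0 := rfl

include d in
/-- The dual of a finitely generated projective left module is injective. -/
theorem injective_dualLeft : Injective (dualLeft k Q) where
  factors {X Y} g f _ := by
    obtain ⟨l, rfl⟩ := d.nakayama_surjective k X g
    have hf : Function.Injective f := (ModuleCat.mono_iff_injective f).mp ‹_›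
    -- Composition with the monomorphism f is injective on Hom(P, -), so the form corresponding to g
    -- extends from Hom(P, X) to Hom(P, Y).
    let F : (P →ₗ[Λᵐᵒᵖ] X) →ₗ[k] (P →ₗ[Λᵐᵒᵖ] Y) :=
      { toFun := fun t => f.hom ∘ₗ t
        map_add' := fun t t' => LinearMap.comp_add _ _ _
        map_smul' := fun c t => LinearMap.ext fun x => by
          change f (c • t x) = c • f (t x)
          rw [smul_eq_algebraMap_smul, map_smul, smul_eq_algebraMap_smul] }
    have hF : Function.Injective F := fun t t' h =>
      LinearMap.ext fun x => hf (LinearMap.congr_fun h x)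
    obtain ⟨l', rfl⟩ := LinearMap.dualMap_surjective_of_injective hF l
    refine ⟨d.nakayama k Y l', ModuleCat.hom_ext (LinearMap.ext fun x => toForm_injective k
      (LinearMap.ext fun y => congrArg l' (LinearMap.ext fun z => ?_)))⟩
    exact (map_smul f.hom _ _).symm

variable {P' : ModuleCat.{u} Λᵐᵒᵖ} {Q' : ModuleCat.{u} Λ} (d' : DualPair P' Q')
  (f : P →ₗ[Λᵐᵒᵖ] P') (f' : Q' ⟶ Q) (hff' : ∀ y x, d.pair (f' y) x = d'.pair y (f x))

include hff' in
theorem nakayama_naturality (X : ModuleCat.{u} Λᵐᵒᵖ) (l : Module.Dual k (P →ₗ[Λᵐᵒᵖ] X)) :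
    d.nakayama k X l ≫ dualLeftMap k f' =
      d'.nakayama k X ((LinearMap.lcomp k X f).dualMap l) := by
  refine ModuleCat.hom_ext (LinearMap.ext fun x => toForm_injective k (LinearMap.ext fun y => ?_))
  refine congrArg l (LinearMap.ext fun z => ?_)
  change MulOpposite.op (d.pair (f' y) z) • x = MulOpposite.op (d'.pair y (f z)) • x
  rw [hff']

include hff' in
-- Surjectivity dualizes to injectivity of D Hom(P, X) → D Hom(P', X), which the Nakayama pairing
-- identifies with Hom(X, DQ) → Hom(X, DQ').
theorem lcomp_surjective_iff (X : ModuleCat.{u} Λᵐᵒᵖ) :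
    Function.Surjective (LinearMap.lcomp k X f) ↔
      ∀ h : X ⟶ dualLeft k Q, h ≫ dualLeftMap k f' = 0 → h = 0 := by
  rw [← LinearMap.dualMap_injective_iff, ← LinearMap.ker_eq_bot, LinearMap.ker_eq_bot']
  constructor
  · intro H h hh
    obtain ⟨l, rfl⟩ := d.nakayama_surjective k X h
    rw [d.nakayama_naturality k d' f f' hff', ← d'.nakayama_zero k X] at hh
    rw [H l (d'.nakayama_injective k X hh), d.nakayama_zero]
  · intro H l hl
    refine d.nakayama_injective k X (H _ ?_)
    rw [d.nakayama_naturality k d' f f' hff', hl, d'.nakayama_zero]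

include hff' in
-- Dual to the surjective case: the Nakayama pairing turns surjectivity of the transposed map into a
-- lifting property along `dualLeftMap k f'`.
theorem lcomp_injective_iff (X : ModuleCat.{u} Λᵐᵒᵖ) :
    Function.Injective (LinearMap.lcomp k X f) ↔
      ∀ h : X ⟶ dualLeft k Q', ∃ g : X ⟶ dualLeft k Q, g ≫ dualLeftMap k f' = h := by
  rw [← LinearMap.dualMap_surjective_iff]
  constructor
  · intro H h
    obtain ⟨l, rfl⟩ := d'.nakayama_surjective k X h
    obtain ⟨l', rfl⟩ := H l
    exact ⟨d.nakayama k X l', d.nakayama_naturality k d' f f' hff' X l'⟩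
  · intro H l
    obtain ⟨g, hg⟩ := H (d'.nakayama k X l)
    obtain ⟨l', rfl⟩ := d.nakayama_surjective k X g
    rw [d.nakayama_naturality k d' f f' hff'] at hg
    exact ⟨l', d'.nakayama_injective k X hg⟩

end DualPair

end DualPairs

/-! ### A criterion for `τ`-rigidity -/

section TauRigid

attribute [local instance] ModuleCat.moduleOfAlgebraModule
attribute [local instance] ModuleCat.isScalarTower_of_algebra_moduleCat

variable (k : Type u) [Field k]

instance {R : Type u} [Ring R] [Algebra k R] [FiniteDimensional k R] (M : ModuleCat.{u} R)
    [Module.Finite R M] : Module.Projective R (projectiveCover k M) :=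
  (isProjectiveCover_projectiveCoverMap k M).projective

variable {Λ : Type u} [Ring Λ] [Algebra k Λ] [FiniteDimensional k Λ]

/-- For the minimal projective presentation `P₁ → P₀ → M`, the module `M` is `τ`-rigid if and only
if `Hom(P₀, M) → Hom(P₁, M)` is surjective. -/
theorem isTauRigid_iff_lcomp_surjective (M : ModuleCat.{u} Λᵐᵒᵖ) [Module.Finite Λᵐᵒᵖ M] :
    IsTauRigid k M ↔ Function.Surjective (LinearMap.lcomp k M (presentationMap k M)) := by
  obtain ⟨d₀, h₀⟩ := exists_dualPair_right (projectiveCover k M)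
  obtain ⟨d₁, h₁⟩ := exists_dualPair_right (projectiveCover k (syzygy k M))
  let f' : ModuleCat.of Λ (projectiveCover k M →ₗ[Λᵐᵒᵖ] Λ) ⟶
      ModuleCat.of Λ (projectiveCover k (syzygy k M) →ₗ[Λᵐᵒᵖ] Λ) :=
    ModuleCat.ofHom (LinearMap.lcomp Λ Λ (presentationMap k M))
  have hf' : ∀ y x, d₁.pair (f' y) x = d₀.pair y (presentationMap k M x) := by
    rw [h₀, h₁]
    exact fun _ _ => rfl
  rw [d₁.lcomp_surjective_iff k d₀ (presentationMap k M) f' hf']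
  -- Dualizing P₀* → P₁* → Tr M → 0 exhibits τM as the kernel of D(P₁*) → D(P₀*).
  let p : ModuleCat.of Λ (projectiveCover k (syzygy k M) →ₗ[Λᵐᵒᵖ] Λ) ⟶ transposeRight k M :=
    ModuleCat.ofHom (LinearMap.range (LinearMap.lcomp Λ Λ (presentationMap k M))).mkQ
  have hp : Function.Surjective p := Submodule.mkQ_surjective _
  have hker : ∀ y, p y = 0 ↔ ∃ z, f' z = y := fun y => Submodule.Quotient.mk_eq_zero _
  constructor
  · intro H h hh
    obtain ⟨g, rfl⟩ := exists_comp_dualLeftMap_eq k p hp h fun x y hy => by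
      obtain ⟨z, rfl⟩ := (hker y).mp hy
      exact (comp_dualLeftMap_eq_zero_iff k f' h).mp hh x z
    exact (congrArg (· ≫ dualLeftMap k p) (H g)).trans Limits.zero_comp
  · intro H g
    have h0 : g ≫ dualLeftMap k p = 0 := by
      refine H _ ((comp_dualLeftMap_eq_zero_iff k f' _).mpr fun x y => ?_)
      exact (congrArg (toForm k (g x)) ((hker _).mpr ⟨y, rfl⟩)).trans (map_zero _)
    refine ModuleCat.hom_ext (LinearMap.ext fun x => dualLeftMap_injective k p hp ?_)
    exact LinearMap.congr_fun (congrArg ModuleCat.Hom.hom h0) x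

/-- Auslander-Smalø: `M` is `τ`-rigid if and only if `Ext¹(M, X) = 0` for all quotients `X`
of `M`. -/
theorem isTauRigid_iff_extendsFromKernels (M : ModuleCat.{u} Λᵐᵒᵖ) [Module.Finite Λᵐᵒᵖ M] :
    IsTauRigid k M ↔ ∀ (X : ModuleCat.{u} Λᵐᵒᵖ) (q : M →ₗ[Λᵐᵒᵖ] X), Function.Surjective q →
      ExtendsFromKernels M X := by
  rw [isTauRigid_iff_lcomp_surjective]
  have hπ := isProjectiveCover_projectiveCoverMap k (syzygy k M)
  set π := projectiveCoverMap k (syzygy k M)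
  constructor
  · intro H X q hq
    refine extendsFromKernels_of_projective (projectiveCoverMap k M).hom
      (isProjectiveCover_projectiveCoverMap k M).surjective fun f => ?_
    -- Pulled back to P₁, the map ΩM → X lifts through q to M, and this lift extends to P₀.
    obtain ⟨t, ht⟩ := Module.projective_lifting_property q (f ∘ₗ π.hom) hq
    obtain ⟨s, hs⟩ := H t
    refine ⟨q ∘ₗ s, fun x => ?_⟩
    obtain ⟨y, rfl⟩ := hπ.surjective x
    exact (congrArg q (LinearMap.congr_fun hs y)).trans (LinearMap.congr_fun ht y)
  · intro H t
    -- t need not factor through ΩM, but it does modulo N = t(ker π); this is the quotient of M to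
    -- which the hypothesis is applied.
    let N := (LinearMap.ker π.hom).map t
    have hker : LinearMap.ker π.hom ≤ LinearMap.ker (N.mkQ ∘ₗ t) := by
      intro x hx
      exact (Submodule.Quotient.mk_eq_zero N).mpr ⟨x, hx, rfl⟩
    let f : syzygy k M →ₗ[Λᵐᵒᵖ] M ⧸ N := (LinearMap.ker π.hom).liftQ (N.mkQ ∘ₗ t) hker ∘ₗ
      (π.hom.quotKerEquivOfSurjective hπ.surjective).symm.toLinearMap
    have hf : ∀ x, f (π x) = N.mkQ (t x) := fun x => by
      have h1 : (π.hom.quotKerEquivOfSurjective hπ.surjective).symm (π x) =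
          (LinearMap.ker π.hom).mkQ x := by
        rw [LinearEquiv.symm_apply_eq]
        rfl
      change (LinearMap.ker π.hom).liftQ (N.mkQ ∘ₗ t) hker
        ((π.hom.quotKerEquivOfSurjective hπ.surjective).symm (π x)) = _
      rw [h1]
      rfl
    obtain ⟨g, hg⟩ := H (ModuleCat.of _ (M ⧸ N)) N.mkQ N.mkQ_surjective (projectiveCover k M)
      (projectiveCoverMap k M).hom (isProjectiveCover_projectiveCoverMap k M).surjective f
    obtain ⟨s, hs⟩ := Module.projective_lifting_property N.mkQ g N.mkQ_surjective
    refine ⟨s, ?_⟩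
    have hN : ∀ x, t x - s (presentationMap k M x) ∈ N := fun x => by
      rw [← Submodule.Quotient.mk_eq_zero, Submodule.Quotient.mk_sub, sub_eq_zero]
      exact (hf x).symm.trans
        ((hg (π x)).symm.trans (LinearMap.congr_fun hs (presentationMap k M x)).symm)
    -- The difference takes values in t(ker π), and on ker π it equals t. So its kernel and ker π
    -- together span P₁, and minimality of the presentation makes it zero.
    have htop : LinearMap.ker (t - s ∘ₗ presentationMap k M) = ⊤ := by
      refine hπ.superfluous _ (Submodule.eq_top_iff'.mpr fun x => ?_)
      obtain ⟨y, hy, hxy⟩ := hN x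
      have hy' : presentationMap k M y = 0 := by
        change ((π.hom y : syzygy k M) : LinearMap.ker (projectiveCoverMap k M).hom).1 = 0
        rw [LinearMap.mem_ker.mp hy]
        rfl
      refine Submodule.mem_sup.mpr ⟨x - y, ?_, y, hy, sub_add_cancel x y⟩
      rw [LinearMap.mem_ker, LinearMap.sub_apply, LinearMap.comp_apply, map_sub, map_sub, hy',
        map_sub, map_zero, sub_zero, hxy]
      abel
    ext x
    exact (sub_eq_zero.mp (LinearMap.ker_eq_top.mp htop ▸ rfl :
      (t - s ∘ₗ presentationMap k M) x = 0)).symm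

end TauRigid

/-! ### `τ`-rigidity over the relation extension -/

section Balanced

attribute [local instance] ModuleCat.moduleOfAlgebraModule
attribute [local instance] ModuleCat.isScalarTower_of_algebra_moduleCat

variable (k : Type u) [Field k] {C : Type u} [Ring C] [Algebra k C]

/-- Additive maps `P × E → X` that are `C`-balanced and `C`-linear in the second argument, that is,
morphisms `P ⊗ E → X`. -/
structure IsBalanced {P X : ModuleCat.{u} Cᵐᵒᵖ} (β : P →+ relExtBimodule k C →+ X) : Prop where
  balanced : ∀ (c : C) (x : P) (e : relExtBimodule k C), β (MulOpposite.op c • x) e = β x (c • e)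
  linear : ∀ (c : Cᵐᵒᵖ) (x : P) (e : relExtBimodule k C), β x (c • e) = c • β x e

/-- There is no nonzero morphism `P ⊗ E → X`. -/
def BalancedVanish (P X : ModuleCat.{u} Cᵐᵒᵖ) : Prop :=
  ∀ β : P →+ relExtBimodule k C →+ X, IsBalanced k β → β = 0

variable {k} in
-- P ⊗ E → M ⊗ E is surjective, so Hom(M ⊗ E, X) embeds in Hom(P ⊗ E, X).
theorem BalancedVanish.of_surjective {P M X : ModuleCat.{u} Cᵐᵒᵖ} (h : BalancedVanish k P X)
    (f : P →ₗ[Cᵐᵒᵖ] M) (hf : Function.Surjective f) : BalancedVanish k M X := by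
  intro β hβ
  have h0 := h (β.comp f.toAddMonoidHom)
    ⟨fun c x e => (congrArg (β · e) (map_smul f (MulOpposite.op c) x)).trans
      (hβ.balanced c (f x) e), fun c x e => hβ.linear c (f x) e⟩
  ext m e
  obtain ⟨x, rfl⟩ := hf m
  exact DFunLike.congr_fun (DFunLike.congr_fun h0 x) e

theorem inr_smul_toRelationExtension (M : ModuleCat.{u} Cᵐᵒᵖ) (e : relExtBimodule k C)
    (m : toRelationExtension k M) :
    MulOpposite.op (TrivSqZeroExt.inr e : RelationExtension k C) • m = 0 :=
  zero_smul Cᵐᵒᵖ (show M from m)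

variable (C) in
/-- The inclusion of `C` into the relation extension, on opposite rings. -/
def inlOp : Cᵐᵒᵖ →+* (RelationExtension k C)ᵐᵒᵖ :=
  RingHom.op (TrivSqZeroExt.inlHom C (relExtBimodule k C))

theorem eq_inl_add_inr (b : (RelationExtension k C)ᵐᵒᵖ) :
    b = inlOp k C (MulOpposite.op (TrivSqZeroExt.fst b.unop)) +
      MulOpposite.op (TrivSqZeroExt.inr (TrivSqZeroExt.snd b.unop)) :=
  MulOpposite.unop_injective (TrivSqZeroExt.inl_fst_add_inr_snd_eq b.unop).symm

/-- A module over the relation extension as a module over `C`. -/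
def restrictInl (X : ModuleCat.{u} (RelationExtension k C)ᵐᵒᵖ) : ModuleCat.{u} Cᵐᵒᵖ :=
  (ModuleCat.restrictScalars (inlOp k C)).obj X

variable [FiniteDimensional k C]

/-- The only obstruction to treating an extension of B-modules as one of C-modules is the action of
E on the middle term, and this is a morphism from M ⊗ E. -/
theorem isTauRigid_toRelationExtension (M : ModuleCat.{u} Cᵐᵒᵖ) [Module.Finite Cᵐᵒᵖ M]
    (hM : IsTauRigid k M)
    (hβ : ∀ (X : ModuleCat.{u} Cᵐᵒᵖ) (q : M →ₗ[Cᵐᵒᵖ] X), Function.Surjective q →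
      BalancedVanish k M X) :
    IsTauRigid k (toRelationExtension k M) := by
  rw [isTauRigid_iff_extendsFromKernels] at hM ⊢
  intro X q hq Z p hp f
  let q' : M →ₗ[Cᵐᵒᵖ] restrictInl k X :=
    { toFun := fun m => q m
      map_add' := fun x y => map_add q _ _
      map_smul' := fun c m => map_smul q (inlOp k C c) (show toRelationExtension k M from m) }
  have hq' : Function.Surjective q' := hq
  let p' : restrictInl k Z →ₗ[Cᵐᵒᵖ] M :=
    { toFun := fun z => p z
      map_add' := fun x y => map_add p _ _
      map_smul' := fun c z => map_smul p (inlOp k C c) (show Z from z) }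
  have hp' : Function.Surjective p' := hp
  let f' : LinearMap.ker p' →ₗ[Cᵐᵒᵖ] restrictInl k X :=
    { toFun := fun z => f ⟨z.1, z.2⟩
      map_add' := fun x y => map_add f ⟨x.1, x.2⟩ ⟨y.1, y.2⟩
      map_smul' := fun c z => map_smul f (inlOp k C c) ⟨z.1, z.2⟩ }
  let r : relExtBimodule k C → (RelationExtension k C)ᵐᵒᵖ :=
    fun e => MulOpposite.op (TrivSqZeroExt.inr e)
  have hr_add : ∀ e e', r (e + e') = r e + r e' := fun e e' =>
    congrArg MulOpposite.op (TrivSqZeroExt.inr_add C e e')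
  have hX : ∀ e (x : X), r e • x = 0 := fun e x => by
    obtain ⟨m, rfl⟩ := hq x
    rw [← map_smul, inr_smul_toRelationExtension, map_zero]
  have hmem : ∀ e (z : Z), r e • z ∈ LinearMap.ker p := fun e z => by
    rw [LinearMap.mem_ker, map_smul, inr_smul_toRelationExtension]
  -- E kills M, so Z·E lies in ker p and f can be applied to it; as E kills X too, F vanishes on ker
  -- p and depends on z only through p z.
  let F : Z → relExtBimodule k C → X := fun z e => f ⟨r e • z, hmem e z⟩
  have hF_add_right : ∀ z e e', F z (e + e') = F z e + F z e' := fun z e e' => by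
    rw [← map_add]
    refine congrArg f (Subtype.ext ?_)
    change r (e + e') • z = r e • z + r e' • z
    rw [hr_add, add_smul]
  have hF_add_left : ∀ z z' e, F (z + z') e = F z e + F z' e := fun z z' e => by
    rw [← map_add]
    exact congrArg f (Subtype.ext (smul_add _ _ _))
  have hF_ker : ∀ z e, p z = 0 → F z e = 0 := fun z e hz =>
    (map_smul f (r e) ⟨z, hz⟩).trans (hX _ _)
  have hF : ∀ z z' e, p z = p z' → F z e = F z' e := fun z z' e hz => by
    have h1 := hF_add_left (z - z') z' e
    rw [sub_add_cancel, hF_ker (z - z') e (by rw [map_sub, hz, sub_self]), zero_add] at h1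
    exact h1
  have hF_balanced : ∀ (c : C) z e, F (inlOp k C (MulOpposite.op c) • z) e = F z (c • e) :=
    fun c z e => congrArg f (Subtype.ext (by
      change r e • inlOp k C (MulOpposite.op c) • z = r (c • e) • z
      rw [← mul_smul]
      congr 1
      exact congrArg MulOpposite.op (TrivSqZeroExt.inl_mul_inr c e)))
  have hF_linear : ∀ (c : Cᵐᵒᵖ) z e, F z (c • e) = inlOp k C c • F z e := fun c z e => by
    refine (congrArg f (Subtype.ext ?_)).trans (map_smul f (inlOp k C c) ⟨r e • z, hmem e z⟩)
    change r (c • e) • z = inlOp k C c • r e • z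
    rw [← mul_smul]
    congr 1
    exact (congrArg MulOpposite.op (TrivSqZeroExt.inr_mul_inl c.unop e)).symm
  -- A set-theoretic section is enough to descend F to M, since F z depends only on p z.
  let σ := Function.surjInv hp
  have hσ : ∀ m, p (σ m) = m := Function.surjInv_eq hp
  let β : M →+ relExtBimodule k C →+ restrictInl k X :=
    AddMonoidHom.mk' (fun m => AddMonoidHom.mk' (fun e => F (σ m) e) (hF_add_right _))
      fun m m' => by
        ext e
        change F (σ (m + m')) e = F (σ m) e + F (σ m') e
        rw [← hF_add_left]
        exact hF _ _ _ ((hσ _).trans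
          ((map_add p _ _).trans (congrArg₂ (· + ·) (hσ m) (hσ m'))).symm)
  have hβ0 : β = 0 := hβ _ q' hq' β
    ⟨fun c m e => by
      change F (σ (MulOpposite.op c • m)) e = F (σ m) (c • e)
      rw [← hF_balanced]
      exact hF _ _ _ ((hσ _).trans
        ((map_smul p _ _).trans (congrArg (inlOp k C (MulOpposite.op c) • ·) (hσ m))).symm),
    fun c m e => hF_linear c _ e⟩
  have hF0 : ∀ z e, F z e = 0 := fun z e =>
    (hF z (σ (p z)) e (hσ _).symm).trans
      (DFunLike.congr_fun (DFunLike.congr_fun hβ0 (p z)) e)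
  obtain ⟨g, hg⟩ := hM _ q' hq' (restrictInl k Z) p' hp' f'
  let G : Z →+ X := show Z →+ X from g.toAddMonoidHom
  refine ⟨
    { toFun := G
      map_add' := map_add G
      map_smul' := fun b z => ?_ }, fun z => hg ⟨z.1, z.2⟩⟩
  -- B-linearity splits into C-linearity, which holds for g, and compatibility with E, where both
  -- sides are zero.
  obtain ⟨c, e, rfl⟩ : ∃ c e, b = inlOp k C c + r e := ⟨_, _, eq_inl_add_inr k b⟩
  have h1 : G (r e • z) = 0 := (hg ⟨_, hmem e z⟩).trans (hF0 z e)
  have h2 : G (inlOp k C c • z) = inlOp k C c • G z := map_smul g c (show restrictInl k Z from z)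
  rw [RingHom.id_apply, add_smul, add_smul, map_add, h1, h2, hX]

/-- The extension of `P` by `X` over the relation extension that is afforded by a balanced map. -/
@[reducible]
def balancedExtension {P X : ModuleCat.{u} Cᵐᵒᵖ} (β : P →+ relExtBimodule k C →+ X)
    (hβ : IsBalanced k β) : Module (RelationExtension k C)ᵐᵒᵖ (X × P) where
  smul b z := (MulOpposite.op (TrivSqZeroExt.fst b.unop) • z.1 + β z.2 (TrivSqZeroExt.snd b.unop),
    MulOpposite.op (TrivSqZeroExt.fst b.unop) • z.2)
  one_smul z := Prod.ext
    ((congrArg₂ (· + ·) (one_smul Cᵐᵒᵖ z.1) (map_zero (β z.2))).trans (add_zero _))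
    (one_smul Cᵐᵒᵖ z.2)
  mul_smul b b' z := Prod.ext
    (by
      -- The two cross terms of the product in B match by linearity and by balancedness of β.
      change MulOpposite.op (TrivSqZeroExt.fst b'.unop * TrivSqZeroExt.fst b.unop) • z.1 +
        β z.2 (TrivSqZeroExt.fst b'.unop • TrivSqZeroExt.snd b.unop +
          MulOpposite.op (TrivSqZeroExt.fst b.unop) • TrivSqZeroExt.snd b'.unop) =
        MulOpposite.op (TrivSqZeroExt.fst b.unop) •
          (MulOpposite.op (TrivSqZeroExt.fst b'.unop) • z.1 +
            β z.2 (TrivSqZeroExt.snd b'.unop)) +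
          β (MulOpposite.op (TrivSqZeroExt.fst b'.unop) • z.2) (TrivSqZeroExt.snd b.unop)
      rw [map_add, hβ.balanced, hβ.linear, smul_add, MulOpposite.op_mul, mul_smul]
      abel)
    (mul_smul (MulOpposite.op (TrivSqZeroExt.fst b.unop))
      (MulOpposite.op (TrivSqZeroExt.fst b'.unop)) z.2)
  smul_zero b := Prod.ext
    ((congrArg₂ (· + ·) (smul_zero _) (DFunLike.congr_fun (map_zero β) _)).trans (add_zero _))
    (smul_zero _)
  smul_add b z z' := Prod.ext
    (by
      change _ • (z.1 + z'.1) + β (z.2 + z'.2) _ = (_ • z.1 + β z.2 _) + (_ • z'.1 + β z'.2 _)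
      rw [smul_add, map_add, AddMonoidHom.add_apply]
      abel)
    (smul_add _ _ _)
  add_smul b b' z := Prod.ext
    (by
      change (MulOpposite.op (TrivSqZeroExt.fst b.unop) +
        MulOpposite.op (TrivSqZeroExt.fst b'.unop)) • z.1 +
        β z.2 (TrivSqZeroExt.snd b.unop + TrivSqZeroExt.snd b'.unop) =
        (_ • z.1 + β z.2 _) + (_ • z.1 + β z.2 _)
      rw [add_smul, map_add]
      abel)
    (add_smul (MulOpposite.op (TrivSqZeroExt.fst b.unop))
      (MulOpposite.op (TrivSqZeroExt.fst b'.unop)) z.2)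
  zero_smul z := Prod.ext
    ((congrArg₂ (· + ·) (zero_smul Cᵐᵒᵖ z.1) (map_zero (β z.2))).trans (add_zero _))
    (zero_smul Cᵐᵒᵖ z.2)

/-- Let E act on X × P through β. The identity of X extends to a B-morphism g on X × P, and since E
kills X, β(x, e) = g((0, x)e) = g(0, x)e = 0. -/
theorem balancedVanish_of_isTauRigid (P : ModuleCat.{u} Cᵐᵒᵖ) [Module.Finite Cᵐᵒᵖ P]
    (hP : IsTauRigid k (toRelationExtension k P)) {X : ModuleCat.{u} Cᵐᵒᵖ} (q : P →ₗ[Cᵐᵒᵖ] X)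
    (hq : Function.Surjective q) : BalancedVanish k P X := by
  rw [isTauRigid_iff_extendsFromKernels] at hP
  intro β hβ
  let _ := balancedExtension k β hβ
  let q' : toRelationExtension k P →ₗ[(RelationExtension k C)ᵐᵒᵖ] toRelationExtension k X :=
    { toFun := fun x => q x
      map_add' := fun x y => map_add q _ _
      map_smul' := fun b x => map_smul q (MulOpposite.op (TrivSqZeroExt.fst b.unop)) (show P from x) }
  let p : (X × P) →ₗ[(RelationExtension k C)ᵐᵒᵖ] toRelationExtension k P :=
    { toFun := fun z => z.2
      map_add' := fun _ _ => rfl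
      map_smul' := fun _ _ => rfl }
  let f : LinearMap.ker p →ₗ[(RelationExtension k C)ᵐᵒᵖ] toRelationExtension k X :=
    { toFun := fun z => z.1.1
      map_add' := fun _ _ => rfl
      map_smul' := fun b z => by
        have hz : z.1.2 = 0 := z.2
        change MulOpposite.op (TrivSqZeroExt.fst b.unop) • z.1.1 + β z.1.2 _ =
          MulOpposite.op (TrivSqZeroExt.fst b.unop) • z.1.1
        rw [hz, map_zero]
        exact add_zero _ }
  obtain ⟨g, hg⟩ := hP _ q' hq (ModuleCat.of _ (X × P)) p (fun x => ⟨(0, x), rfl⟩) f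
  ext x e
  have h1 : MulOpposite.op (TrivSqZeroExt.inr e : RelationExtension k C) • ((0 : X), x) =
      (β x e, (0 : P)) :=
    Prod.ext ((congrArg (· + β x e) (zero_smul Cᵐᵒᵖ (0 : X))).trans (zero_add _))
      (zero_smul Cᵐᵒᵖ x)
  have h2 : g (β x e, (0 : P)) = β x e := hg ⟨(β x e, (0 : P)), rfl⟩
  rw [← h2, ← h1]
  exact (map_smul g _ _).trans (inr_smul_toRelationExtension k X e _)

end Balanced

/-! ### Balanced maps and second extensions -/

section SecondExt

open Abelian

attribute [local instance] ModuleCat.moduleOfAlgebraModule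
attribute [local instance] ModuleCat.isScalarTower_of_algebra_moduleCat

variable (k : Type u) [Field k] {C : Type u} [Ring C] [Algebra k C]

/-- Evaluation of a form on `C` at an element of `C`. -/
def formAt (y : C) : dualAlgebra k C →+ k where
  toFun f := toForm k f (show leftRegular C from y)
  map_zero' := rfl
  map_add' _ _ := rfl

theorem dualAlgebra_ext {f g : dualAlgebra k C} (h : ∀ y, formAt k y f = formAt k y g) : f = g :=
  toForm_injective k (LinearMap.ext h)

theorem formAt_smul (y c : C) (f : dualAlgebra k C) :
    formAt k y (MulOpposite.op c • f) = formAt k (c * y) f := rfl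

theorem formAt_one_smul (y : C) (f : dualAlgebra k C) :
    formAt k 1 (MulOpposite.op y • f) = formAt k y f := by
  rw [formAt_smul, mul_one]

theorem formAt_algebraMap_smul (y : C) (a : k) (f : dualAlgebra k C) :
    formAt k y (algebraMap k Cᵐᵒᵖ a • f) = a * formAt k y f := by
  refine Eq.trans ?_ (map_smul (toForm k f) a (show leftRegular C from y))
  exact congrArg (toForm k f) (algebraMap_smul C a (show leftRegular C from y))

/-- The form g ↦ (f g)(1) on DC is evaluation at some c, by reflexivity of C; right linearity of f
then determines f g at every other point. -/
theorem exists_eq_leftMulDual [FiniteDimensional k C] (f : dualAlgebra k C ⟶ dualAlgebra k C) :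
    ∃ c : C, f = leftMulDual k C c := by
  have : Module.Finite k (leftRegular C) := finiteDimensional_of_finite k _
  let l : Module.Dual k (Module.Dual k (leftRegular C)) :=
    { toFun := fun g => formAt k (1 : C) (f (show dualAlgebra k C from g))
      map_add' := fun g h => congrArg (formAt k (1 : C))
        (map_add f.hom (show dualAlgebra k C from g) (show dualAlgebra k C from h))
      map_smul' := fun a g => by
        have h1 : (show dualAlgebra k C from a • g) =
            algebraMap k Cᵐᵒᵖ a • (show dualAlgebra k C from g) :=
          dualAlgebra_ext k fun y => (formAt_algebraMap_smul k y a _).symm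
        exact (congrArg (fun t => formAt k (1 : C) (f t)) h1).trans
          ((congrArg (formAt k (1 : C)) (map_smul f.hom _ _)).trans
            (formAt_algebraMap_smul k 1 a _)) }
  obtain ⟨c, hc⟩ : ∃ c : C, ∀ g, l g = g (show leftRegular C from c) := by
    obtain ⟨c, hc⟩ := (Module.evalEquiv k (leftRegular C)).surjective l
    exact ⟨c, fun g => (LinearMap.congr_fun hc g).symm⟩
  have h1 : ∀ g : dualAlgebra k C, formAt k c g = formAt k 1 (f g) :=
    fun g => (hc g).symm
  refine ⟨c, ModuleCat.hom_ext (LinearMap.ext fun g => dualAlgebra_ext k fun y => ?_)⟩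
  change formAt k y (f g) = formAt k (y * c) g
  rw [← formAt_smul, h1, map_smul, formAt_one_smul]

/-! ### Coordinates on finite powers of a module -/

section Powers

variable {R : Type u} [Ring R] (A : ModuleCat.{u} R) {n : ℕ}

/-- The inclusion of a factor into a finite power. -/
def powInc (s : Fin n) : A ⟶ ModuleCat.of R (Fin n → A) :=
  ModuleCat.ofHom (LinearMap.single R (fun _ => A) s)

/-- The projection of a finite power onto a factor. -/
def powProj (s : Fin n) : ModuleCat.of R (Fin n → A) ⟶ A := ModuleCat.ofHom (LinearMap.proj s)

theorem powInc_powProj_self (s : Fin n) : powInc A s ≫ powProj A s = 𝟙 A :=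
  ModuleCat.hom_ext (LinearMap.ext fun x => Pi.single_eq_same (M := fun _ => A) s x)

theorem powInc_powProj_of_ne {s t : Fin n} (h : s ≠ t) : powInc A s ≫ powProj A t = 0 :=
  ModuleCat.hom_ext (LinearMap.ext fun x => Pi.single_eq_of_ne (M := fun _ => A) h.symm x)

theorem sum_powInc_apply (x : ModuleCat.of R (Fin n → A)) :
    ∑ s, powInc A s (powProj A s x) = x :=
  Finset.univ_sum_single (show Fin n → A from x)

theorem sum_powProj_powInc : ∑ s, powProj A s ≫ powInc A s = 𝟙 (ModuleCat.of R (Fin n → A)) := by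
  refine ModuleCat.hom_ext (LinearMap.ext fun x => ?_)
  rw [ModuleCat.hom_sum, LinearMap.sum_apply]
  exact sum_powInc_apply A x

end Powers

/-- Every finitely generated module embeds into a finite power of `DC`. -/
theorem exists_embedding_dualAlgebra [FiniteDimensional k C] (X : ModuleCat.{u} Cᵐᵒᵖ)
    [Module.Finite Cᵐᵒᵖ X] : ∃ (n : ℕ) (i : X ⟶ ModuleCat.of Cᵐᵒᵖ (Fin n → dualAlgebra k C)),
      Function.Injective i := by
  have := finiteDimensional_of_finite k X
  let b := Module.finBasis k X
  let F (j : Fin (Module.finrank k X)) : X ⟶ dualAlgebra k C := homDual k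
    { toFun := fun x =>
        { toFun := fun a => b.coord j (MulOpposite.op (show C from a) • x)
          map_add' := fun a a' => by
            rw [← map_add, ← add_smul]
            rfl
          map_smul' := fun c a => by
            rw [RingHom.id_apply, ← map_smul, ← smul_assoc]
            congr 2
            exact congrArg MulOpposite.op (algebraMap_smul C c (show C from a)) }
      map_zero' := LinearMap.ext fun a => by
        change b.coord j (_ • (0 : X)) = 0
        rw [smul_zero, map_zero]
      map_add' := fun x y => LinearMap.ext fun a => by
        change b.coord j (_ • (x + y)) = b.coord j _ + b.coord j _
        rw [smul_add, map_add] }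
    (fun a x y => by
      change b.coord j (MulOpposite.op (show C from y) • a • x) =
        b.coord j (MulOpposite.op (a.unop * (show C from y)) • x)
      rw [← mul_smul]
      rfl)
  refine ⟨_, ModuleCat.ofHom (LinearMap.pi fun j => (F j).hom), ?_⟩
  change Function.Injective (LinearMap.pi fun j => (F j).hom)
  rw [← LinearMap.ker_eq_bot, LinearMap.ker_eq_bot']
  intro x hx
  refine b.ext_elem fun j => ?_
  have h1 : b.coord j (MulOpposite.op (1 : C) • x) = 0 :=
    LinearMap.congr_fun (congrArg (toForm k) (congrFun hx j)) (1 : C)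
  rw [MulOpposite.op_one, one_smul] at h1
  simpa using h1

variable (C) in
/-- `Ext²(DC, C)` as the bimodule `E`. -/
def toBimodule : Ext.{u} (dualAlgebra k C) (rightRegular C) 2 →+ relExtBimodule k C :=
  AddMonoidHom.id _

theorem toBimodule_leftMulDual_comp (c : C)
    (e : Ext.{u} (dualAlgebra k C) (rightRegular C) 2) :
    toBimodule k C ((Ext.mk₀ (leftMulDual k C c)).comp e (zero_add 2)) =
      MulOpposite.op c • toBimodule k C e := rfl

theorem toBimodule_comp_leftMul (c : C) (e : Ext.{u} (dualAlgebra k C) (rightRegular C) 2) :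
    toBimodule k C (e.comp (Ext.mk₀ (leftMul C c)) (add_zero 2)) = c • toBimodule k C e := rfl

/-- If `Ext²(X, P)` and `Ext³(-, P)` vanish for a finitely generated projective module `P`, then
there is no nonzero morphism `P ⊗ Ext²(DC, C) → X`. -/
theorem balancedVanish_of_ext_two [FiniteDimensional k C] (P X : ModuleCat.{u} Cᵐᵒᵖ)
    [Module.Finite Cᵐᵒᵖ P] [Module.Projective Cᵐᵒᵖ P] [Module.Finite Cᵐᵒᵖ X]
    [Subsingleton (Ext.{u} X P 2)]
    (hP : ∀ W : ModuleCat.{u} Cᵐᵒᵖ, Module.Finite Cᵐᵒᵖ W → Subsingleton (Ext.{u} W P 3)) :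
    BalancedVanish k P X := by
  have := isArtinianRing_of_finiteDimensional k (R := Cᵐᵒᵖ)
  intro β hβ
  obtain ⟨n, i, hi⟩ := exists_embedding_dualAlgebra k X
  -- A copresentation 0 → X → J → J' by powers of DC; the two vanishing hypotheses make Ext²(J', P)
  -- → Ext²(J, P) surjective.
  let J := ModuleCat.of Cᵐᵒᵖ (Fin n → dualAlgebra k C)
  have : Module.Finite Cᵐᵒᵖ J := inferInstanceAs (Module.Finite Cᵐᵒᵖ (Fin n → dualAlgebra k C))
  let Z := ModuleCat.of Cᵐᵒᵖ (J ⧸ LinearMap.range i.hom)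
  obtain ⟨m, j, hj⟩ := exists_embedding_dualAlgebra k Z
  let J' := ModuleCat.of Cᵐᵒᵖ (Fin m → dualAlgebra k C)
  have : Module.Finite Cᵐᵒᵖ J' := inferInstanceAs (Module.Finite Cᵐᵒᵖ (Fin m → dualAlgebra k C))
  let a : J ⟶ J' := ModuleCat.ofHom (j.hom ∘ₗ (LinearMap.range i.hom).mkQ)
  have hia : Function.Exact i a := fun x => by
    change j ((LinearMap.range i.hom).mkQ x) = 0 ↔ x ∈ LinearMap.range i.hom
    exact (map_eq_zero_iff j.hom hj).trans (Submodule.Quotient.mk_eq_zero _)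
  have := hP (ModuleCat.of _ (J' ⧸ LinearMap.range a.hom)) inferInstance
  have hsurj : ∀ e : Ext.{u} J P 2, ∃ e', (Ext.mk₀ a).comp e' (zero_add 2) = e :=
    fun e => exists_precomp_eq_of_exact i a hi hia e
  -- Since every endomorphism of DC is left multiplication by an element of C, the map a is a matrix
  -- over C.
  choose c hc using fun s t =>
    exists_eq_leftMulDual k (powInc (dualAlgebra k C) s ≫ a ≫ powProj _ t)
  obtain ⟨N, p, q, hpq⟩ := exists_dualBasis_right P
  let Q (r : Fin N) : P ⟶ rightRegular C := ModuleCat.ofHom (Y := rightRegular C) (q r)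
  let g (s : Fin n) : X ⟶ dualAlgebra k C := i ≫ powProj (dualAlgebra k C) s
  -- This is the relation a ∘ i = 0, read off in the coordinate t and evaluated at 1.
  have hcg : ∀ t x, ∑ s, formAt k (c s t) (g s x) = 0 := by
    intro t x
    have h1 : ∀ s, formAt k (c s t) (g s x) = formAt k 1 (powProj (dualAlgebra k C) t (a
        (powInc (dualAlgebra k C) s (powProj (dualAlgebra k C) s (i x))))) := fun s => by
      have h2 := congrArg (fun f : dualAlgebra k C ⟶ dualAlgebra k C => formAt k 1 (f (g s x)))
        (hc s t)
      refine Eq.trans ?_ h2.symm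
      change _ = formAt k (1 * c s t) (g s x)
      rw [one_mul]
    rw [Finset.sum_congr rfl fun s _ => h1 s, ← map_sum, ← map_sum, ← map_sum, sum_powInc_apply,
      (hia _).mpr ⟨x, rfl⟩, map_zero, map_zero]
  -- the trace functional attached to `β`
  let Ψ (e : Ext.{u} J P 2) : k := ∑ s, ∑ r, formAt k 1 (g s (β (p r) (toBimodule k C
    (((Ext.mk₀ (powInc (dualAlgebra k C) s)).comp e (zero_add 2)).comp (Ext.mk₀ (Q r))
      (add_zero 2)))))
  -- Linearity of β moves the matrix entries of a from the extension classes to the coordinates of X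
  -- in J, where they cancel because a ∘ i = 0.
  have hΨa : ∀ e', Ψ ((Ext.mk₀ a).comp e' (zero_add 2)) = 0 := by
    intro e'
    let η (r : Fin N) (t : Fin m) : relExtBimodule k C := toBimodule k C
      (((Ext.mk₀ (powInc (dualAlgebra k C) t)).comp e' (zero_add 2)).comp (Ext.mk₀ (Q r))
        (add_zero 2))
    have h1 : ∀ s, powInc (dualAlgebra k C) s ≫ a =
        ∑ t, leftMulDual k C (c s t) ≫ powInc (dualAlgebra k C) t := fun s => by
      simp_rw [← hc, Category.assoc, ← Preadditive.comp_sum]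
      rw [sum_powProj_powInc]
      rfl
    have h2 : ∀ s r, toBimodule k C (((Ext.mk₀ (powInc (dualAlgebra k C) s)).comp
        ((Ext.mk₀ a).comp e' (zero_add 2)) (zero_add 2)).comp (Ext.mk₀ (Q r)) (add_zero 2)) =
        ∑ t, MulOpposite.op (c s t) • η r t := fun s r => by
      rw [Ext.mk₀_comp_mk₀_assoc, h1, Ext.mk₀_sum, Ext.sum_comp, Ext.sum_comp, map_sum]
      refine Finset.sum_congr rfl fun t _ => ?_
      rw [← toBimodule_leftMulDual_comp, ← Ext.mk₀_comp_mk₀_assoc,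
        Ext.comp_assoc_of_third_deg_zero]
    have h3 : ∀ s r, formAt k 1 (g s (β (p r) (∑ t, MulOpposite.op (c s t) • η r t))) =
        ∑ t, formAt k (c s t) (g s (β (p r) (η r t))) := fun s r => by
      rw [map_sum, map_sum, map_sum]
      refine Finset.sum_congr rfl fun t _ => ?_
      rw [hβ.linear, map_smul, formAt_one_smul]
    change ∑ s, ∑ r, formAt k 1 (g s (β (p r) (toBimodule k C (((Ext.mk₀ (powInc
      (dualAlgebra k C) s)).comp ((Ext.mk₀ a).comp e' (zero_add 2)) (zero_add 2)).comp
        (Ext.mk₀ (Q r)) (add_zero 2))))) = 0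
    simp_rw [h2, h3]
    rw [Finset.sum_comm]
    refine Finset.sum_eq_zero fun r _ => ?_
    rw [Finset.sum_comm]
    exact Finset.sum_eq_zero fun t _ => hcg t _
  have hΨ : ∀ e, Ψ e = 0 := fun e => by
    obtain ⟨e', rfl⟩ := hsurj e
    exact hΨa e'
  have hβ1 : ∀ s x e, formAt k 1 (g s (β x e)) = 0 := by
    intro s x e
    let x' : rightRegular C ⟶ P := ModuleCat.ofHom (X := rightRegular C)
      { toFun := fun c => MulOpposite.op (show C from c) • x
        map_add' := fun c c' => add_smul (MulOpposite.op (show C from c))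
          (MulOpposite.op (show C from c')) x
        map_smul' := fun c c' => mul_smul c (MulOpposite.op (show C from c')) x }
    have hx' : ∀ r, x' ≫ Q r = leftMul C (q r x) := fun r => ModuleCat.hom_ext (LinearMap.ext
      fun y => map_smul (q r) (MulOpposite.op (show C from y)) x)
    let e₀ : Ext.{u} (dualAlgebra k C) (rightRegular C) 2 := e
    -- The class e placed on the factor s of J and pushed forward along C → P, 1 ↦ x. By the dual
    -- basis and balancedness of β, Ψ ξ is the s-th coordinate of β x e at 1.
    let ξ : Ext.{u} J P 2 := (Ext.mk₀ (powProj (dualAlgebra k C) s)).comp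
      (e₀.comp (Ext.mk₀ x') (add_zero 2)) (zero_add 2)
    rw [← hΨ ξ]
    symm
    refine (Finset.sum_eq_single s (fun t _ hts => ?_) (by simp)).trans ?_
    · refine Finset.sum_eq_zero fun r _ => ?_
      rw [Ext.mk₀_comp_mk₀_assoc, powInc_powProj_of_ne _ hts, Ext.mk₀_zero, Ext.zero_comp,
        Ext.zero_comp, map_zero, map_zero, map_zero, map_zero]
    · rw [← map_sum, ← map_sum]
      congr 2
      conv_rhs => rw [← hpq x, map_sum, AddMonoidHom.finsetSum_apply]
      refine Finset.sum_congr rfl fun r _ => ?_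
      rw [Ext.mk₀_comp_mk₀_assoc, powInc_powProj_self, Ext.mk₀_id_comp,
        Ext.comp_assoc_of_third_deg_zero, Ext.mk₀_comp_mk₀, hx', toBimodule_comp_leftMul,
        hβ.balanced]
      rfl
  ext x e
  refine hi ?_
  rw [AddMonoidHom.zero_apply, AddMonoidHom.zero_apply, map_zero]
  refine funext fun s => dualAlgebra_ext k fun y => ?_
  -- Multiplying e by y turns evaluation at 1 into evaluation at y.
  have h1 := hβ1 s x (MulOpposite.op y • e)
  rw [hβ.linear, map_smul, formAt_one_smul] at h1
  exact h1

end SecondExt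

/-! ### The inverse Auslander-Reiten translation of a module of injective dimension at most one -/

section TauInv

open Abelian

attribute [local instance] ModuleCat.moduleOfAlgebraModule
attribute [local instance] ModuleCat.isScalarTower_of_algebra_moduleCat

variable (k : Type u) [Field k] {Λ : Type u} [Ring Λ] [Algebra k Λ]

/-- A projective cover `π` for which the monomorphism `D π` splits is an isomorphism. -/
theorem injective_of_dualLeftMap_split [FiniteDimensional k Λ] {Q K : ModuleCat.{u} Λ}
    [Module.Finite Λ Q] {π : Q ⟶ K} (hπ : IsProjectiveCover π)
    (r : dualLeft k Q ⟶ dualLeft k K) (hr : dualLeftMap k π ≫ r = 𝟙 _) :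
    Function.Injective π := by
  have := finiteDimensional_of_finite k Q
  have hr' : ∀ g, r (dualLeftMap k π g) = g := fun g =>
    LinearMap.congr_fun (congrArg ModuleCat.Hom.hom hr) g
  -- S is the annihilator in Q of V = ker r; proving S = Q amounts to proving r injective.
  let S : Submodule Λ Q :=
    { carrier := {y | ∀ g, r g = 0 → toForm k g y = 0}
      add_mem' := fun {x y} hx hy g hg => by rw [map_add, hx g hg, hy g hg, add_zero]
      zero_mem' := fun g _ => map_zero _
      smul_mem' := fun a y hy g hg => by
        have h1 := hy (MulOpposite.op a • g) (by rw [map_smul, hg, smul_zero])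
        exact h1 }
  let V : Subspace k (Module.Dual k Q) :=
    { carrier := {g | r (show dualLeft k Q from g) = 0}
      add_mem' := fun {g h} hg hh => (map_add r.hom (show dualLeft k Q from g)
        (show dualLeft k Q from h)).trans ((congrArg₂ (· + ·) hg hh).trans (add_zero _))
      zero_mem' := map_zero r.hom
      smul_mem' := fun c g hg => by
        have h1 : (show dualLeft k Q from c • g) =
            algebraMap k Λᵐᵒᵖ c • (show dualLeft k Q from g) := by
          refine toForm_injective k (LinearMap.ext fun y => ?_)
          refine (map_smul g c y).symm.trans ?_
          exact (congrArg g (algebraMap_smul Λ c y)).symm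
        exact (congrArg r h1).trans ((map_smul r.hom _ _).trans
          ((congrArg (algebraMap k Λᵐᵒᵖ c • ·) hg).trans (smul_zero _))) }
  have hS : S = ⊤ := by
    refine hπ.superfluous S ?_
    by_contra hne
    -- Otherwise some nonzero form f kills S and ker π. Killing S puts f in ker r by the double
    -- annihilator theorem, killing ker π gives f = Dπ(g), and then g = r f = 0.
    have hlt : (S ⊔ LinearMap.ker π.hom).restrictScalars k < ⊤ := by
      rw [lt_top_iff_ne_top]
      intro h
      exact hne (Submodule.restrictScalars_injective k Λ Q h)
    obtain ⟨f, hf0, hf⟩ := Submodule.exists_le_ker_of_lt_top _ hlt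
    have hfS : ∀ y ∈ S, f y = 0 := fun y hy =>
      hf (Submodule.mem_sup_left hy : y ∈ S ⊔ LinearMap.ker π.hom)
    have hfπ : ∀ y, π y = 0 → f y = 0 := fun y hy =>
      hf (Submodule.mem_sup_right hy : y ∈ S ⊔ LinearMap.ker π.hom)
    have hfV : f ∈ V := by
      rw [← Subspace.dualCoannihilator_dualAnnihilator_eq (W := V), Submodule.mem_dualAnnihilator]
      intro y hy
      exact hfS y fun g hg => (Submodule.mem_dualCoannihilator y).mp hy _ hg
    let ι : ModuleCat.of Λ (LinearMap.ker π.hom) ⟶ Q :=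
      ModuleCat.ofHom (LinearMap.ker π.hom).subtype
    have hex : Function.Exact ι π := LinearMap.exact_subtype_ker_map π.hom
    obtain ⟨g, hg⟩ := (dualLeftMap_exact k ι π hπ.surjective hex (show dualLeft k Q from f)).mp
      (toForm_injective k (LinearMap.ext fun y => hfπ _ y.2))
    have hg0 : g = 0 := by
      rw [← hr' g, hg]
      exact hfV
    refine hf0 (Eq.trans (show f = toForm k (dualLeftMap k π g) from
      congrArg (toForm k) hg.symm) ?_)
    rw [hg0, map_zero, map_zero]
  -- r is injective and inverts Dπ on one side, hence on both. So every form on Q comes from K and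
  -- vanishes on ker π.
  have hsurj : ∀ g, dualLeftMap k π (r g) = g := fun g => by
    refine (sub_eq_zero.mp (toForm_injective k (LinearMap.ext fun y => ?_))).symm
    have hy : y ∈ S := hS ▸ Submodule.mem_top
    exact hy _ (by rw [map_sub, hr', sub_self])
  refine (injective_iff_map_eq_zero π.hom).mpr fun y hy => ?_
  rw [← Module.forall_dual_apply_eq_zero_iff k]
  intro f
  have h1 := LinearMap.congr_fun (congrArg (toForm k) (hsurj (show dualLeft k Q from f))) y
  rw [toForm_dualLeftMap] at h1
  refine h1.symm.trans ?_
  exact (congrArg _ hy).trans (map_zero _)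

variable [FiniteDimensional k Λ]

/-- The inclusion of the syzygy in the projective cover. -/
def syzygyInclusion (N : ModuleCat.{u} Λ) [Module.Finite Λ N] :
    syzygy k N ⟶ projectiveCover k N :=
  ModuleCat.ofHom (LinearMap.ker (projectiveCoverMap k N).hom).subtype

theorem dual_syzygy_shortExact (N : ModuleCat.{u} Λ) [Module.Finite Λ N] :
    (ShortComplex.mk (dualLeftMap k (projectiveCoverMap k N)) (dualLeftMap k (syzygyInclusion k N))
      (ModuleCat.hom_ext (LinearMap.ext fun f => (dualLeftMap_exact k (syzygyInclusion k N)
        (projectiveCoverMap k N) (isProjectiveCover_projectiveCoverMap k N).surjective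
        (LinearMap.exact_subtype_ker_map _) _).mpr ⟨f, rfl⟩))).ShortExact :=
  dualLeftMap_shortExact k _ _ (Submodule.injective_subtype _)
    (isProjectiveCover_projectiveCoverMap k N).surjective (LinearMap.exact_subtype_ker_map _)

theorem injective_dual_projectiveCover (N : ModuleCat.{u} Λ) [Module.Finite Λ N] :
    Injective (dualLeft k (projectiveCover k N)) := by
  obtain ⟨d, -⟩ := exists_dualPair_left (projectiveCover k N)
  exact d.injective_dualLeft k

/-- If `Y` has injective dimension at most one, then the projective cover of the syzygy of `D Y` is
an isomorphism. -/
theorem injective_projectiveCoverMap_syzygy_dual (Y : ModuleCat.{u} Λᵐᵒᵖ) [Module.Finite Λᵐᵒᵖ Y]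
    (hY : ∀ W : ModuleCat.{u} Λᵐᵒᵖ, Module.Finite Λᵐᵒᵖ W → Subsingleton (Ext.{u} W Y 2)) :
    Function.Injective (projectiveCoverMap k (syzygy k (dualRight k Y))) := by
  have := isArtinianRing_of_finiteDimensional k (R := Λ)
  let N := dualRight k Y
  let π := projectiveCoverMap k (syzygy k N)
  let L := ModuleCat.of Λ (LinearMap.ker π.hom)
  have : Module.Finite Λ L := inferInstanceAs (Module.Finite Λ (LinearMap.ker π.hom))
  let ι : L ⟶ projectiveCover k (syzygy k N) := ModuleCat.ofHom (LinearMap.ker π.hom).subtype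
  have hS := dualLeftMap_shortExact k ι π (Submodule.injective_subtype _)
    (isProjectiveCover_projectiveCoverMap k (syzygy k N)).surjective
    (LinearMap.exact_subtype_ker_map _)
  obtain ⟨e⟩ := nonempty_iso_doubleDual k Y
  -- With L = ker π, the vanishing of Ext²(DL, Y) shifts down the dual of the syzygy sequence to
  -- Ext¹(DL, DΩ(DY)) = 0, which splits Dπ.
  have := hY (dualLeft k L) inferInstance
  have : Subsingleton (Ext.{u} (dualLeft k L) (dualLeft k N) (1 + 1)) :=
    subsingleton_ext_of_iso _ e.symm 2
  have := injective_dual_projectiveCover k N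
  have : Subsingleton (Ext.{u} (dualLeft k L) (dualLeft k (projectiveCover k N)) 1) :=
    Ext.subsingleton_of_injective _ _ 0
  have : Subsingleton (Ext.{u} (dualLeft k L) (dualLeft k (syzygy k N)) 1) :=
    subsingleton_ext_X₃ (dual_syzygy_shortExact k N) (dualLeft k L) 1
  obtain ⟨r, hr⟩ := exists_extension_of_ext_one hS (𝟙 (dualLeft k (syzygy k N)))
  exact injective_of_dualLeftMap_split k (isProjectiveCover_projectiveCoverMap k _) r hr

/-- If `Y` has injective dimension at most one, then `Hom(τ⁻¹ Y, X) = 0` if and only if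
`Ext¹(X, Y) = 0`. -/
theorem hom_tauInv_eq_zero_iff (Y X : ModuleCat.{u} Λᵐᵒᵖ) [Module.Finite Λᵐᵒᵖ Y]
    (hY : ∀ W : ModuleCat.{u} Λᵐᵒᵖ, Module.Finite Λᵐᵒᵖ W → Subsingleton (Ext.{u} W Y 2)) :
    (∀ h : tauInv k Y ⟶ X, h = 0) ↔ Subsingleton (Ext.{u} X Y 1) := by
  let N := dualRight k Y
  let Q₀ := projectiveCover k N
  let Q₁ := projectiveCover k (syzygy k N)
  let π := projectiveCoverMap k (syzygy k N)
  have hπ : Function.Surjective π := (isProjectiveCover_projectiveCoverMap k _).surjective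
  have hπ' : Function.Injective π := injective_projectiveCoverMap_syzygy_dual k Y hY
  obtain ⟨d₀, h₀⟩ := exists_dualPair_left Q₀
  obtain ⟨d₁, h₁⟩ := exists_dualPair_left Q₁
  let f : ModuleCat.of Λᵐᵒᵖ (Q₀ →ₗ[Λ] Λ) →ₗ[Λᵐᵒᵖ] ModuleCat.of Λᵐᵒᵖ (Q₁ →ₗ[Λ] Λ) :=
    LinearMap.lcomp Λᵐᵒᵖ Λ (presentationMap k N)
  let f' : Q₁ ⟶ Q₀ := ModuleCat.ofHom (presentationMap k N)
  have hff' : ∀ y x, d₀.pair (f' y) x = d₁.pair y (f x) := fun y x => by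
    rw [h₀, h₁]
    rfl
  -- τ⁻¹Y is the cokernel of Q₀* → Q₁*, so its maps to X are the maps from Q₁* that vanish on the
  -- image of Q₀*.
  have key₁ : (∀ h : tauInv k Y ⟶ X, h = 0) ↔ Function.Injective (LinearMap.lcomp k X f) := by
    rw [← LinearMap.ker_eq_bot, LinearMap.ker_eq_bot']
    constructor
    · intro H t ht
      have hle : LinearMap.range f ≤ LinearMap.ker t := by
        rintro _ ⟨x, rfl⟩
        exact LinearMap.congr_fun ht x
      have h1 := H (ModuleCat.ofHom ((LinearMap.range f).liftQ t hle))
      ext x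
      exact LinearMap.congr_fun (congrArg ModuleCat.Hom.hom h1) ((LinearMap.range f).mkQ x)
    · intro H h
      have h1 := H (h.hom ∘ₗ (LinearMap.range f).mkQ) (LinearMap.ext fun x => by
        change h.hom ((LinearMap.range f).mkQ (f x)) = 0
        have h2 : (LinearMap.range f).mkQ (f x) = 0 :=
          (Submodule.Quotient.mk_eq_zero _).mpr ⟨x, rfl⟩
        exact (congrArg h.hom h2).trans (map_zero _))
      refine ModuleCat.hom_ext (LinearMap.ext fun x => ?_)
      obtain ⟨y, rfl⟩ := (LinearMap.range f).mkQ_surjective x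
      exact LinearMap.congr_fun h1 y
  -- As π is an isomorphism, D Q₁ may be replaced by D(ΩN); lifting along D Q₀ → D(ΩN), whose kernel
  -- is DN ≅ Y, is governed by Ext¹(X, Y).
  have key₂ : (∀ h : X ⟶ dualLeft k Q₁, ∃ g : X ⟶ dualLeft k Q₀, g ≫ dualLeftMap k f' = h) ↔
      ∀ h : X ⟶ dualLeft k (syzygy k N), ∃ g : X ⟶ dualLeft k Q₀,
        g ≫ dualLeftMap k (syzygyInclusion k N) = h := by
    constructor
    · intro H h
      obtain ⟨g, hg⟩ := H (h ≫ dualLeftMap k π)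
      refine ⟨g, ModuleCat.hom_ext (LinearMap.ext fun x => dualLeftMap_injective k π hπ ?_)⟩
      exact LinearMap.congr_fun (congrArg ModuleCat.Hom.hom hg) x
    · intro H h
      obtain ⟨h', rfl⟩ := exists_comp_dualLeftMap_eq k π hπ h fun x y hy => by
        rw [(map_eq_zero_iff π.hom hπ').mp hy, map_zero]
      obtain ⟨g, rfl⟩ := H h'
      exact ⟨g, rfl⟩
  obtain ⟨e⟩ := nonempty_iso_doubleDual k Y
  have := injective_dual_projectiveCover k N
  have : Subsingleton (Ext.{u} X (dualLeft k Q₀) 1) := Ext.subsingleton_of_injective _ _ 0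
  rw [key₁, d₀.lcomp_injective_iff k d₁ f f' hff', key₂]
  constructor
  · intro H
    have : Subsingleton (Ext.{u} X (dualLeft k N) 1) :=
      subsingleton_ext_one_of_lift (dual_syzygy_shortExact k N) H
    exact subsingleton_ext_of_iso X e 1
  · intro _
    have : Subsingleton (Ext.{u} X (dualLeft k N) 1) := subsingleton_ext_of_iso X e.symm 1
    exact exists_lift_of_ext_one (dual_syzygy_shortExact k N)

/-- If `P` has injective dimension at most two, then `Hom(τ⁻¹ Ω⁻¹ P, X) = 0` if and only if
`Ext²(X, P) = 0`. -/
theorem hom_tauInv_cosyzygy_eq_zero_iff (P X : ModuleCat.{u} Λᵐᵒᵖ) [Module.Finite Λᵐᵒᵖ P]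
    (hP : ∀ W : ModuleCat.{u} Λᵐᵒᵖ, Module.Finite Λᵐᵒᵖ W → Subsingleton (Ext.{u} W P 3)) :
    (∀ h : tauInv k (cosyzygy k P) ⟶ X, h = 0) ↔ Subsingleton (Ext.{u} X P 2) := by
  have henv := isInjectiveEnvelope_injectiveEnvelopeMap k P
  let q : injectiveEnvelope k P ⟶ cosyzygy k P :=
    ModuleCat.ofHom (LinearMap.range (injectiveEnvelopeMap k P).hom).mkQ
  have hex : Function.Exact (injectiveEnvelopeMap k P) q :=
    LinearMap.exact_map_mkQ_range (injectiveEnvelopeMap k P).hom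
  have hS : (ShortComplex.mk (injectiveEnvelopeMap k P) q (ModuleCat.hom_ext (LinearMap.ext
      fun x => (hex _).mpr ⟨x, rfl⟩))).ShortExact :=
    ModuleCat.shortComplex_shortExact _ hex henv.injective (Submodule.mkQ_surjective _)
  have := henv.injective_obj
  have : Injective (injectiveEnvelope k P) :=
    Module.injective_object_of_injective_module Λᵐᵒᵖ (injectiveEnvelope k P)
  -- With an injective middle term, Extⁿ(W, Ω⁻¹P) and Extⁿ⁺¹(W, P) vanish together for n ≥ 1. The
  -- case n = 2 bounds the injective dimension of Ω⁻¹P by one; n = 1 gives the equivalence.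
  have hI : ∀ (W : ModuleCat.{u} Λᵐᵒᵖ) n,
      Subsingleton (Ext.{u} W (injectiveEnvelope k P) (n + 1)) :=
    fun W n => Ext.subsingleton_of_injective _ _ n
  rw [hom_tauInv_eq_zero_iff k (cosyzygy k P) X]
  · constructor
    · intro _
      have := hI X 1
      exact subsingleton_ext_X₁ hS X 1
    · intro (_ : Subsingleton (Ext.{u} X P (1 + 1)))
      have := hI X 0
      exact subsingleton_ext_X₃ hS X 1
  · intro W hW
    have : Subsingleton (Ext.{u} W P (2 + 1)) := hP W hW
    have := hI W 1
    exact subsingleton_ext_X₃ hS W 2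

end TauInv

/-! ### The criteria for `τ`-rigidity over the relation extension -/

section Criteria

open Abelian

variable (k : Type u) [Field k] {C : Type u} [Ring C] [Algebra k C] [FiniteDimensional k C]

theorem inGen_of_surjective {M X : ModuleCat.{u} Cᵐᵒᵖ} [Module.Finite Cᵐᵒᵖ M]
    (q : M →ₗ[Cᵐᵒᵖ] X) (hq : Function.Surjective q) : InGen M X :=
  ⟨Module.Finite.of_surjective q hq, 1, q ∘ₗ LinearMap.proj 0,
    fun x => (hq x).imp' (fun m _ => m) fun _ h => h⟩

/-- A `τ_C`-rigid module generated by a finitely generated projective module `P` is `τ_B`-rigid if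
`Ext²(X, P) = 0` for all its quotients `X`. -/
theorem isTauRigid_of_ext_two (hC : GlobalDimensionLE Cᵐᵒᵖ 2) {P M : ModuleCat.{u} Cᵐᵒᵖ}
    [Module.Finite Cᵐᵒᵖ P] [Module.Projective Cᵐᵒᵖ P] [Module.Finite Cᵐᵒᵖ M]
    (f : P →ₗ[Cᵐᵒᵖ] M) (hf : Function.Surjective f) (hM : IsTauRigid k M)
    (hExt : ∀ (X : ModuleCat.{u} Cᵐᵒᵖ) (q : M →ₗ[Cᵐᵒᵖ] X), Function.Surjective q →
      Subsingleton (Ext.{u} X P 2)) :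
    IsTauRigid k (toRelationExtension k M) := by
  refine isTauRigid_toRelationExtension k M hM fun X q hq => ?_
  have := hExt X q hq
  have : Module.Finite Cᵐᵒᵖ X := Module.Finite.of_surjective q hq
  exact (balancedVanish_of_ext_two k P X fun W hW =>
    (hC W hW).subsingleton _ _ 3 le_rfl P).of_surjective f hf

/-- Projective dimension at most one makes Ext¹(M, -) right exact, so its vanishing passes from M to
the quotients of M. -/
theorem IsPartialTilting.isTauRigid {M : ModuleCat.{u} Cᵐᵒᵖ} [Module.Finite Cᵐᵒᵖ M]
    (hM : IsPartialTilting M) : IsTauRigid k M := by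
  rw [isTauRigid_iff_extendsFromKernels]
  intro X q hq
  have := hM.1
  have : Subsingleton (Ext.{u} M M 1) := subsingleton_of_forall_eq 0 hM.2
  have hS := LinearMap.shortExact_shortComplexKer hq
  have : Subsingleton (Ext.{u} M q.shortComplexKer.X₂ 1) := this
  have : Subsingleton (Ext.{u} M q.shortComplexKer.X₁ (1 + 1)) :=
    HasProjectiveDimensionLT.subsingleton M 2 2 le_rfl _
  have : Subsingleton (Ext.{u} M X 1) := subsingleton_ext_X₃ hS M 1
  exact extendsFromKernels_of_ext_one M X

/-- If `Hom(Ω T, M) = 0`, then every map from `T` to a quotient of `M` lifts to `M`. -/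
theorem exists_lift_of_hom_syzygy_eq_zero {R : Type u} [Ring R] [Algebra k R]
    [FiniteDimensional k R] (T : ModuleCat.{u} R) [Module.Finite R T] {M X : ModuleCat.{u} R}
    (h : ∀ g : syzygy k T ⟶ M, g = 0) (q : M →ₗ[R] X) (hq : Function.Surjective q) (g : T ⟶ X) :
    ∃ g' : T ⟶ M, q ∘ₗ g'.hom = g.hom := by
  have hp := isProjectiveCover_projectiveCoverMap k T
  have := hp.projective
  obtain ⟨l, hl⟩ := Module.projective_lifting_property q (g.hom ∘ₗ (projectiveCoverMap k T).hom) hq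
  -- The restriction of l to ΩT is a map ΩT → M, hence zero, so l descends to T.
  have hker : LinearMap.ker (projectiveCoverMap k T).hom ≤ LinearMap.ker l := fun x hx =>
    LinearMap.congr_fun (congrArg ModuleCat.Hom.hom (h (ModuleCat.ofHom (X := syzygy k T)
      (l ∘ₗ (LinearMap.ker (projectiveCoverMap k T).hom).subtype)))) ⟨x, hx⟩
  let e := (projectiveCoverMap k T).hom.quotKerEquivOfSurjective hp.surjective
  refine ⟨ModuleCat.ofHom ((LinearMap.ker _).liftQ l hker ∘ₗ e.symm.toLinearMap),
    LinearMap.ext fun t => ?_⟩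
  obtain ⟨y, rfl⟩ := e.surjective t
  obtain ⟨x, rfl⟩ := (LinearMap.ker (projectiveCoverMap k T).hom).mkQ_surjective y
  change q ((LinearMap.ker _).liftQ l hker (e.symm (e _))) = _
  rw [LinearEquiv.symm_apply_apply]
  exact LinearMap.congr_fun hl x

end Criteria

end

end RelExt

/-! ### The proposition and its three corollaries -/

open CategoryTheory RelExt in
theorem proposition4p2 {k : Type u} [Field k] [IsAlgClosed k] {C : Type u} [Ring C] [Algebra k C]
    [FiniteDimensional k C] (hC : GlobalDimensionLE Cᵐᵒᵖ 2)
    (M : ModuleCat.{u} Cᵐᵒᵖ) [Module.Finite Cᵐᵒᵖ M] :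
    -- the proposition
    (∀ (P₀ : ModuleCat.{u} Cᵐᵒᵖ) [Module.Finite Cᵐᵒᵖ P₀] (f : P₀ ⟶ M), IsProjectiveCover f →
      IsTauRigid k M →
      (∀ X : ModuleCat.{u} Cᵐᵒᵖ, InGen M X → ∀ g : tauInv k (cosyzygy k P₀) ⟶ X, g = 0) →
      IsTauRigid k (toRelationExtension k M)) ∧
    -- first corollary
    (IsTauRigid k M →
      (∀ X : ModuleCat.{u} Cᵐᵒᵖ, InGen M X → HasProjectiveDimensionLE X 1) →
      IsTauRigid k (toRelationExtension k M)) ∧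
    -- second corollary
    (∀ (P₀ : ModuleCat.{u} Cᵐᵒᵖ) [Module.Finite Cᵐᵒᵖ P₀] (f : P₀ ⟶ M), IsProjectiveCover f →
      IsTauRigid k M →
      IsTauRigid k (toRelationExtension k P₀) →
      IsTauRigid k (toRelationExtension k M)) ∧
    -- third corollary
    (∀ (P₀ : ModuleCat.{u} Cᵐᵒᵖ) [Module.Finite Cᵐᵒᵖ P₀] (f : P₀ ⟶ M), IsProjectiveCover f →
      IsPartialTilting M →
      (∀ g : syzygy k (tauInv k (cosyzygy k P₀)) ⟶ M, g = 0) →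
      IsTauRigid k (toRelationExtension k M)) := by
  have hExt₃ : ∀ P W : ModuleCat.{u} Cᵐᵒᵖ, Module.Finite Cᵐᵒᵖ W →
      Subsingleton (Abelian.Ext.{u} W P 3) := fun P W hW =>
    (hC W hW).subsingleton _ _ 3 le_rfl P
  refine ⟨fun P₀ _ f hf hM h => ?_, fun hM h => ?_, fun P₀ _ f hf hM hP => ?_,
    fun P₀ _ f hf hM h => ?_⟩
  · have := hf.projective
    exact isTauRigid_of_ext_two k hC f.hom hf.surjective hM fun X q hq =>
      (hom_tauInv_cosyzygy_eq_zero_iff k P₀ X (hExt₃ P₀)).mp (h X (inGen_of_surjective q hq))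
  · exact isTauRigid_of_ext_two k hC (projectiveCoverMap k M).hom
      (isProjectiveCover_projectiveCoverMap k M).surjective hM fun X q hq =>
        (h X (inGen_of_surjective q hq)).subsingleton _ _ 2 le_rfl _
  -- A quotient of M is also a quotient of P₀, so τ_B-rigidity of P₀ gives the vanishing on P₀ ⊗ E,
  -- which descends to M ⊗ E.
  · exact isTauRigid_toRelationExtension k M hM fun X q hq =>
      (balancedVanish_of_isTauRigid k P₀ hP (q ∘ₗ f.hom)
        (hq.comp hf.surjective)).of_surjective f.hom hf.surjective
  · have := hf.projective
    refine isTauRigid_of_ext_two k hC f.hom hf.surjective (hM.isTauRigid k) fun X q hq =>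
      (hom_tauInv_cosyzygy_eq_zero_iff k P₀ X (hExt₃ P₀)).mp fun g => ?_
    -- Since pd M ≤ 1 gives Ext²(M, P₀) = 0, there are no nonzero maps from τ⁻¹Ω⁻¹P₀ to M, and the
    -- lift of g to M must vanish.
    have hT := (hom_tauInv_cosyzygy_eq_zero_iff k P₀ M (hExt₃ P₀)).mpr
      (hM.1.subsingleton _ _ 2 le_rfl P₀)
    obtain ⟨g', hg'⟩ := exists_lift_of_hom_syzygy_eq_zero k _ h q hq g
    refine ModuleCat.hom_ext ?_
    rw [← hg', hT g']
    exact LinearMap.comp_zero q
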